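/- Let $T>0$, let $(\Omega,\mathcal F,P)$ be a probability space and $(\mathcal F_t)_{t\in[0,T]}$ a filtration satisfying the usual conditions (right-continuous and complete), with $\mathcal F_0$ containing only events of probability $0$ or $1$. A $[0,T]$-valued stopping time $\tau$ is predictable if there are stopping times $\sigma_n\uparrow\tau$ a.s. with $\sigma_n<\tau$ for all $n$ a.s. on $\{\tau>0\}$; let $\mathcal T_0^p$ be the set of these. $\mathcal F_{\tau^-}$ is generated by $\mathcal F_0$ and the sets $A\cap\{t<\tau\}$, $A\in\mathcal F_t$, $t\in[0,T]$. An admissible family is a family $\phi=(\phi(\tau))_{\tau\in\mathcal T_0^p}$ such that each $\phi(\tau)$ is an $\mathcal F_{\tau^-}$-measurable $[0,\infty]$-valued random variable and $\phi(\tau)=\phi(\tau')$ a.s. on $\{\tau=\tau'\}$ for all $\tau,\tau'\in\mathcal T_0^p$. Its predictable value function is $$V_p(S)=\operatorname*{ess\,sup}_{\tau\in\mathcal T_0^p,\ \tau\ge S\text{ a.s.}}E[\phi(\tau)\mid\mathcal F_{S^-}],\qquad S\in\mathcal T_0^p .$$ A family $U=(U(\tau))_{\tau\in\mathcal T_0^p}$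 of $[0,\infty]$-valued random variables has the left limit $U(\tau^-)$ at $\tau\in\mathcal T_0^p$ if $U(\tau^-)$ is an $\mathcal F_{\tau^-}$-measurable $[0,\infty]$-valued random variable such that $U(\tau_n)\to U(\tau^-)$ a.s. for every nondecreasing sequence $(\tau_n)$ in $\mathcal T_0^p$ with, a.s., $\tau_n\uparrow\tau$ and $\tau_n<\tau$ for all $n$. The family is left limited if it has a left limit at every $\tau\in\mathcal T_0^p$ with $\tau>0$ a.s. Proposition. Let $\phi$ be a left limited admissible family with $\sup_{\tau\in\mathcal T_0^p}E[\phi(\tau)]<\infty$. Then for every $\tau\in\mathcal T_0^p$ with $\tau>0$ a.s., the family $V_p$ has a left limit at $\tau$, and $$V_p(\tau^-)=\phi(\tau^-)\vee V_p(\tau)\quad\text{a.s.}$$ -/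

import Mathlib

open MeasureTheory Filter Topology
open scoped ENNReal NNReal

namespace OptStop

/-! ### Essential supremum of a family of `[0, ∞]`-valued random variables -/

section EssSup

variable {Ω ι : Type*} {m : MeasurableSpace Ω}

/-- Some countable subfamily has a pointwise supremum that dominates every member almost surely. -/
theorem exists_countable_ae_le_iSup (P : Measure Ω) [IsFiniteMeasure P] (f : ι → Ω → ℝ≥0∞)
    (hf : ∀ i, Measurable (f i)) :
    ∃ s : Set ι, s.Countable ∧ ∀ i, ∀ᵐ ω ∂P, f i ω ≤ ⨆ j ∈ s, f j ω := by
  classical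
  set h : ℝ≥0∞ → ℝ≥0∞ := fun x => (1 + x)⁻¹ with hh
  have h_anti : Antitone h := fun a b hab =>
    ENNReal.inv_le_inv.2 (add_le_add le_rfl hab)
  have h_meas : Measurable h := h_anti.measurable
  set F : Set ι → Ω → ℝ≥0∞ := fun s ω => ⨆ j ∈ s, f j ω with hF
  have F_mono : ∀ {s t : Set ι}, s ⊆ t → ∀ ω, F s ω ≤ F t ω := fun hst ω =>
    biSup_mono (fun i hi => hst hi)
  have F_meas : ∀ {s : Set ι}, s.Countable → Measurable (F s) := fun hs =>
    Measurable.biSup _ hs (fun i _ => hf i)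
  set J : Set ι → ℝ≥0∞ := fun s => ∫⁻ ω, h (F s ω) ∂P with hJ
  have J_fin : ∀ s, J s ≠ ∞ := fun s => by
    have : J s ≤ ∫⁻ _, 1 ∂P := lintegral_mono fun ω => by
      simp only [hh]; exact ENNReal.inv_le_one.2 le_self_add
    exact ne_top_of_le_ne_top (by simp) this
  have J_anti : ∀ {s t : Set ι}, s ⊆ t → J t ≤ J s := fun hst =>
    lintegral_mono fun ω => h_anti (F_mono hst ω)
  set I : Set ℝ≥0∞ := J '' {s | s.Countable} with hI
  have hIne : I.Nonempty := ⟨J ∅, ∅, Set.countable_empty, rfl⟩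
  obtain ⟨u, -, hu, huI⟩ := exists_seq_tendsto_sInf hIne (OrderBot.bddBelow I)
  choose s hs hsu using huI
  refine ⟨⋃ n, s n, Set.countable_iUnion hs, fun i => ?_⟩
  set S := ⋃ n, s n with hS
  have hSc : S.Countable := Set.countable_iUnion hs
  have hSle : J S ≤ sInf I := ge_of_tendsto' hu fun n => by
    rw [← hsu n]; exact J_anti (Set.subset_iUnion s n)
  have hS' : (insert i S).Countable := hSc.insert i
  have hle : J S ≤ J (insert i S) := hSle.trans (sInf_le ⟨_, hS', rfl⟩)
  have hae : ∀ᵐ ω ∂P, h (F (insert i S) ω) = h (F S ω) :=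
    ae_eq_of_ae_le_of_lintegral_le
      (Eventually.of_forall fun ω => h_anti (F_mono (Set.subset_insert i S) ω))
      (J_fin _) (h_meas.comp (F_meas hSc)).aemeasurable hle
  filter_upwards [hae] with ω hω
  have hω' : F (insert i S) ω = F S ω := by
    have h1 : (1 : ℝ≥0∞) + F (insert i S) ω = 1 + F S ω := inv_injective hω
    exact (ENNReal.add_right_inj ENNReal.one_ne_top).1 h1
  calc f i ω ≤ F (insert i S) ω := le_biSup (fun j => f j ω) (Set.mem_insert i S)
    _ = F S ω := hω'

open Classical in
/-- The essential supremum of a family of `[0, ∞]`-valued random variables: the supremum of a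
countable subfamily that dominates every member almost surely
(`0` for a family for which there is no such subfamily; see `exists_countable_ae_le_iSup`). -/
noncomputable def essSupFamily (P : Measure Ω) (f : ι → Ω → ℝ≥0∞) : Ω → ℝ≥0∞ :=
  if h : ∃ s : Set ι, s.Countable ∧ ∀ i, ∀ᵐ ω ∂P, f i ω ≤ ⨆ j ∈ s, f j ω then
    fun ω => ⨆ j ∈ h.choose, f j ω
  else 0

/-- The essential supremum is an almost sure upper bound. -/
theorem le_essSupFamily (P : Measure Ω) [IsFiniteMeasure P] (f : ι → Ω → ℝ≥0∞)
    (hf : ∀ i, Measurable (f i)) (i : ι) : f i ≤ᵐ[P] essSupFamily P f := by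
  have h := exists_countable_ae_le_iSup P f hf
  rw [essSupFamily, dif_pos h]
  exact h.choose_spec.2 i

/-- The essential supremum is below every almost sure upper bound. -/
theorem essSupFamily_le (P : Measure Ω) (f : ι → Ω → ℝ≥0∞) (Z : Ω → ℝ≥0∞)
    (hZ : ∀ i, f i ≤ᵐ[P] Z) : essSupFamily P f ≤ᵐ[P] Z := by
  by_cases h : ∃ s : Set ι, s.Countable ∧ ∀ i, ∀ᵐ ω ∂P, f i ω ≤ ⨆ j ∈ s, f j ω
  · rw [essSupFamily, dif_pos h]
    have := (ae_ball_iff h.choose_spec.1).2 fun i _ => hZ i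
    filter_upwards [this] with ω hω
    exact iSup₂_le hω
  · rw [essSupFamily, dif_neg h]
    exact Eventually.of_forall fun ω => zero_le

/-- The essential supremum inherits measurability with respect to any σ-algebra. -/
theorem measurable_essSupFamily (P : Measure Ω) (f : ι → Ω → ℝ≥0∞) (𝒢 : MeasurableSpace Ω)
    (hf : ∀ i, Measurable[𝒢] (f i)) : Measurable[𝒢] (essSupFamily P f) := by
  by_cases h : ∃ s : Set ι, s.Countable ∧ ∀ i, ∀ᵐ ω ∂P, f i ω ≤ ⨆ j ∈ s, f j ω
  · rw [essSupFamily, dif_pos h]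
    exact Measurable.biSup _ h.choose_spec.1 (fun i _ => hf i)
  · rw [essSupFamily, dif_neg h]
    exact measurable_const

end EssSup

/-! ### Predictable stopping times on `[0, T]`

The time set `[0, T]` is `Set.Iic T` in `ℝ≥0`, with least element `⊥`, i.e. time `0`. -/

section Times

variable {Ω : Type*} {m : MeasurableSpace Ω} {T : ℝ≥0}

/-- A stopping time with values in `[0, T]`. -/
def IsStop (𝓕 : Filtration (Set.Iic T) m) (τ : Ω → Set.Iic T) : Prop :=
  IsStoppingTime 𝓕 (fun ω => (τ ω : WithTop (Set.Iic T)))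

/-- A stopping time is predictable if it is announced by a sequence of stopping times: they
increase to `τ` a.s., and are strictly smaller than `τ` a.s. on `{τ > 0}`. -/
def IsPredictableTime (𝓕 : Filtration (Set.Iic T) m) (P : Measure Ω)
    (τ : Ω → Set.Iic T) : Prop :=
  IsStop 𝓕 τ ∧ ∃ σ : ℕ → Ω → Set.Iic T, (∀ n, IsStop 𝓕 (σ n)) ∧
    ∀ᵐ ω ∂P, Monotone (fun n => σ n ω) ∧ Tendsto (fun n => σ n ω) atTop (𝓝 (τ ω)) ∧
      (⊥ < τ ω → ∀ n, σ n ω < τ ω)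

/-- The predictable stopping times with values in `[0, T]`. -/
abbrev PredictableTime (𝓕 : Filtration (Set.Iic T) m) (P : Measure Ω) : Type _ :=
  {τ : Ω → Set.Iic T // IsPredictableTime 𝓕 P τ}

/-- The σ-algebra `ℱ_{τ-}` of events strictly prior to `τ`, generated by `ℱ_0` and the sets
`A ∩ {t < τ}` with `A ∈ ℱ_t`. -/
@[reducible] def sigmaBefore (𝓕 : Filtration (Set.Iic T) m) (τ : Ω → Set.Iic T) : MeasurableSpace Ω :=
  𝓕 ⊥ ⊔ MeasurableSpace.generateFrom
    {s | ∃ (t : Set.Iic T) (A : Set Ω), MeasurableSet[𝓕 t] A ∧ s = A ∩ {ω | t < τ ω}}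

theorem sigmaBefore_le (𝓕 : Filtration (Set.Iic T) m) {τ : Ω → Set.Iic T} (hτ : IsStop 𝓕 τ) :
    sigmaBefore 𝓕 τ ≤ m := by
  refine sup_le (𝓕.le _) (MeasurableSpace.generateFrom_le ?_)
  rintro _ ⟨t, A, hA, rfl⟩
  have h1 : MeasurableSet {ω | τ ω ≤ t} := by
    have := 𝓕.le t _ (hτ t)
    simpa using this
  have h2 : {ω | t < τ ω} = {ω | τ ω ≤ t}ᶜ := by ext; simp
  exact (𝓕.le t _ hA).inter (h2 ▸ h1.compl)

/-- The usual conditions: right continuity, and `ℱ_0` contains every `P`-null set. -/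
def UsualConditions (𝓕 : Filtration (Set.Iic T) m) (P : Measure Ω) : Prop :=
  𝓕.IsRightContinuous ∧ ∀ s : Set Ω, P s = 0 → MeasurableSet[𝓕 ⊥] s

/-- A (predictable) admissible family: `φ(τ)` is `ℱ_{τ-}`-measurable with values in `[0, ∞]`, and
`φ(τ) = φ(τ')` a.s. on `{τ = τ'}`. -/
def IsAdmissible (𝓕 : Filtration (Set.Iic T) m) (P : Measure Ω)
    (φ : PredictableTime 𝓕 P → Ω → ℝ≥0∞) : Prop :=
  (∀ τ, Measurable[sigmaBefore 𝓕 τ.1] (φ τ)) ∧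
    ∀ τ τ', ∀ᵐ ω ∂P, τ.1 ω = τ'.1 ω → φ τ ω = φ τ' ω

/-- The predictable value function: the essential supremum of the conditional expectations
`E[φ(τ) | ℱ_{S-}]` over the predictable stopping times `τ` with `S ≤ τ` a.s. -/
noncomputable def valueFunction (𝓕 : Filtration (Set.Iic T) m) (P : Measure Ω)
    (φ : PredictableTime 𝓕 P → Ω → ℝ≥0∞) (S : PredictableTime 𝓕 P) : Ω → ℝ≥0∞ :=
  essSupFamily P (fun τ : {τ : PredictableTime 𝓕 P // ∀ᵐ ω ∂P, S.1 ω ≤ τ.1 ω} =>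
    condLExp (sigmaBefore 𝓕 S.1) P (φ τ.1))

/-- `X` is the left limit `φ(τ-)` of the family `φ` at `τ`: it is `ℱ_{τ-}`-measurable, and
`φ(τ_n) → X` a.s. for every nondecreasing sequence of predictable stopping times `τ_n` with
`τ_n ↑ τ` and `τ_n < τ` for all `n`, a.s. -/
def IsLeftLimit (𝓕 : Filtration (Set.Iic T) m) (P : Measure Ω)
    (φ : PredictableTime 𝓕 P → Ω → ℝ≥0∞) (τ : PredictableTime 𝓕 P) (X : Ω → ℝ≥0∞) : Prop :=
  Measurable[sigmaBefore 𝓕 τ.1] X ∧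
    ∀ σ : ℕ → PredictableTime 𝓕 P,
      (∀ᵐ ω ∂P, Monotone (fun n => (σ n).1 ω) ∧
        Tendsto (fun n => (σ n).1 ω) atTop (𝓝 (τ.1 ω)) ∧ ∀ n, (σ n).1 ω < τ.1 ω) →
      ∀ᵐ ω ∂P, Tendsto (fun n => φ (σ n) ω) atTop (𝓝 (X ω))

/-- The family `φ` is left limited: it has a left limit at every predictable stopping time
`τ > 0`. -/
def IsLeftLimited (𝓕 : Filtration (Set.Iic T) m) (P : Measure Ω)
    (φ : PredictableTime 𝓕 P → Ω → ℝ≥0∞) : Prop :=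
  ∀ τ : PredictableTime 𝓕 P, (∀ᵐ ω ∂P, ⊥ < τ.1 ω) → ∃ X, IsLeftLimit 𝓕 P φ τ X

end Times

end OptStop

/-!
The proposition follows from two facts: the value function converges to `φ(τ-) ∨ V_p(τ)` along every
sequence of predictable times announcing `τ` (`isLeftLimit_valueFunction`), and there is such a
sequence, so that left limits are almost surely unique (`IsLeftLimit.ae_eq`).

Predictable times may be pasted along events of `ℱ_{S-}` (`IsPredictableTime.piecewise`). Hence the
conditional expectations defining `V_p(S)` form a directed family, `V_p` is a supermartingale along
nondecreasing sequences of predictable times, and it converges almost surely along these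
(`exists_tendsto_valueFunction`).

Let `s n` announce `τ`. The limit of `V_p(s n)` is at least `φ(τ-)` since `V_p ≥ φ`, and at least
`V_p(τ)` by Lévy's upward theorem. For the converse there need be no uniform integrability, so the
expected rewards cannot be passed to the limit directly. Instead, take `σ n ≥ s n` to be
`2⁻ⁿ`-optimal from `s n` on. By the supermartingale property it remains `2⁻ⁿ`-optimal at all times
between `s n` and `σ n`, on every event known strictly before these times
(`setLIntegral_valueFunction_le_add`). At the times `s k ∧ σ n`, with `k → ∞`, this shows by Fatou's
lemma that the limit exceeds `V_p(τ)` by at most `2⁻ⁿ` in mean on `{τ ≤ σ n}`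
(`setLIntegral_liminf_valueFunction_le`); only the integrability of the single reward `φ(σ n)` is
used. Where `σ n < τ` for almost all `n`, optimality at `σ n` itself gives `V_p(σ n) - φ(σ n) → 0`
almost surely, and the limit is `φ(τ-)` (`le_max_of_tendsto_valueFunction`).
-/

namespace OptStop

section

variable {Ω : Type*} {m : MeasurableSpace Ω} {T : ℝ≥0} {𝓕 : Filtration (Set.Iic T) m}
  {P : Measure Ω}

/-! ### Stopping times under the usual conditions -/

theorem isStop_iff {τ : Ω → Set.Iic T} :
    IsStop 𝓕 τ ↔ ∀ t, MeasurableSet[𝓕 t] {ω | τ ω ≤ t} := by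
  simp [IsStop, IsStoppingTime]

theorem IsStop.measurableSet_le {τ : Ω → Set.Iic T} (hτ : IsStop 𝓕 τ) (t : Set.Iic T) :
    MeasurableSet[𝓕 t] {ω | τ ω ≤ t} := isStop_iff.1 hτ t

theorem IsStop.measurableSet_gt {τ : Ω → Set.Iic T} (hτ : IsStop 𝓕 τ) (t : Set.Iic T) :
    MeasurableSet[𝓕 t] {ω | t < τ ω} := by
  have h : {ω | t < τ ω} = {ω | τ ω ≤ t}ᶜ := by ext; simp
  exact h ▸ (hτ.measurableSet_le t).compl

theorem IsStop.measurableSet_lt {τ : Ω → Set.Iic T} (hτ : IsStop 𝓕 τ) (t : Set.Iic T) :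
    MeasurableSet[𝓕 t] {ω | τ ω < t} := by
  simpa using IsStoppingTime.measurableSet_lt hτ t

theorem IsStop.measurable {τ : Ω → Set.Iic T} (hτ : IsStop 𝓕 τ) : Measurable τ :=
  measurable_of_Iic fun t => 𝓕.le t _ (hτ.measurableSet_le t)

theorem IsStop.min {σ τ : Ω → Set.Iic T} (hσ : IsStop 𝓕 σ) (hτ : IsStop 𝓕 τ) :
    IsStop 𝓕 fun ω => min (σ ω) (τ ω) := by
  refine isStop_iff.2 fun t => ?_
  simp_rw [min_le_iff, Set.ofPred_or]
  exact (hσ.measurableSet_le t).union (hτ.measurableSet_le t)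

theorem IsStop.max {σ τ : Ω → Set.Iic T} (hσ : IsStop 𝓕 σ) (hτ : IsStop 𝓕 τ) :
    IsStop 𝓕 fun ω => max (σ ω) (τ ω) := by
  refine isStop_iff.2 fun t => ?_
  simp_rw [max_le_iff, Set.ofPred_and]
  exact (hσ.measurableSet_le t).inter (hτ.measurableSet_le t)

theorem isStop_of_measurableSet_lt (hF : 𝓕.IsRightContinuous) {τ : Ω → Set.Iic T}
    (hτ : ∀ t, MeasurableSet[𝓕 t] {ω | τ ω < t}) : IsStop 𝓕 τ := by
  refine isStop_iff.2 fun t => ?_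
  by_cases ht : IsMax t
  · have : {ω | τ ω ≤ t} = Set.univ := Set.eq_univ_of_forall fun ω => ht.isTop (τ ω)
    rw [this]
    exact MeasurableSet.univ
  · rw [← hF.eq, Filtration.rightCont_eq_of_not_isMax _ ht]
    simp only [MeasurableSpace.measurableSet_iInf]
    intro j hj
    obtain ⟨u, -, hu, hut⟩ := exists_seq_strictAnti_tendsto' (show t < j from hj)
    have h : {ω | τ ω ≤ t} = ⋂ n, {ω | τ ω < u n} := by
      ext ω
      simp only [Set.mem_ofPred_eq, Set.mem_iInter]
      exact ⟨fun h n => h.trans_lt (hu n).1, fun h => ge_of_tendsto' hut fun n => (h n).le⟩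
    rw [h]
    exact MeasurableSet.iInter fun n => 𝓕.mono (hu n).2.le _ (hτ _)

/-- The pointwise infimum of a sequence of `[0, T]`-valued functions. -/
noncomputable def infTime (ρ : ℕ → Ω → Set.Iic T) (ω : Ω) : Set.Iic T :=
  ⟨⨅ n, (ρ n ω : ℝ≥0), Set.mem_Iic.2 ((ciInf_le (OrderBot.bddBelow _) 0).trans (ρ 0 ω).2)⟩

theorem infTime_lt_iff {ρ : ℕ → Ω → Set.Iic T} {ω : Ω} {t : Set.Iic T} :
    infTime ρ ω < t ↔ ∃ n, ρ n ω < t := by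
  rw [← Subtype.coe_lt_coe, infTime, ciInf_lt_iff (OrderBot.bddBelow _)]
  rfl

theorem le_infTime_iff {ρ : ℕ → Ω → Set.Iic T} {ω : Ω} {t : Set.Iic T} :
    t ≤ infTime ρ ω ↔ ∀ n, t ≤ ρ n ω := by
  rw [← not_lt, infTime_lt_iff]
  simp

theorem IsStop.infTime (hF : 𝓕.IsRightContinuous) {ρ : ℕ → Ω → Set.Iic T}
    (hρ : ∀ n, IsStop 𝓕 (ρ n)) : IsStop 𝓕 (infTime ρ) := by
  refine isStop_of_measurableSet_lt hF fun t => ?_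
  simp_rw [infTime_lt_iff, Set.ofPred_exists]
  exact MeasurableSet.iUnion fun n => (hρ n).measurableSet_lt t

/-- Completeness: events that agree almost surely belong to the same σ-algebras above `ℱ_0`. -/
theorem measurableSet_congr_ae (hU : UsualConditions 𝓕 P) {𝒢 : MeasurableSpace Ω}
    (h𝒢 : 𝓕 ⊥ ≤ 𝒢) {A B : Set Ω} (hA : MeasurableSet[𝒢] A) (hAB : ∀ᵐ ω ∂P, ω ∈ A ↔ ω ∈ B) :
    MeasurableSet[𝒢] B := by
  have hN : ∀ s ⊆ {ω | ¬(ω ∈ A ↔ ω ∈ B)}, MeasurableSet[𝒢] s := fun s hs =>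
    h𝒢 _ (hU.2 s (measure_mono_null hs hAB))
  have h : B = (A \ (A \ B)) ∪ (B \ A) := by
    ext ω
    simp only [Set.mem_union, Set.mem_sdiff]
    tauto
  rw [h]
  refine MeasurableSet.union (MeasurableSet.diff hA (hN _ ?_)) (hN _ ?_)
  · rintro ω ⟨h1, h2⟩
    simp [h1, h2]
  · rintro ω ⟨h1, h2⟩
    simp [h1, h2]

/-- The limit of an almost surely monotone sequence of stopping times is a stopping time. -/
theorem isStop_of_tendsto (hU : UsualConditions 𝓕 P) {ρ : ℕ → Ω → Set.Iic T}
    (hρ : ∀ n, IsStop 𝓕 (ρ n)) {S : Ω → Set.Iic T}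
    (h : ∀ᵐ ω ∂P, Monotone (fun n => ρ n ω) ∧ Tendsto (fun n => ρ n ω) atTop (𝓝 (S ω))) :
    IsStop 𝓕 S := by
  refine isStop_iff.2 fun t => ?_
  refine measurableSet_congr_ae hU (𝓕.mono bot_le) (A := ⋂ n, {ω | ρ n ω ≤ t})
    (MeasurableSet.iInter fun n => (hρ n).measurableSet_le t) ?_
  filter_upwards [h] with ω hω
  simp only [Set.mem_iInter, Set.mem_ofPred_eq]
  exact ⟨fun h => le_of_tendsto' hω.2 h, fun h n => (hω.1.ge_of_tendsto hω.2 n).trans h⟩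

/-- A time approximated by stopping times that are eventually strictly smaller is predictable:
the tail infima of the approximating sequence announce it. -/
theorem isPredictableTime_of_tendsto (hU : UsualConditions 𝓕 P) {ρ : ℕ → Ω → Set.Iic T}
    (hρ : ∀ n, IsStop 𝓕 (ρ n)) {S : Ω → Set.Iic T}
    (h : ∀ᵐ ω ∂P, Tendsto (fun n => ρ n ω) atTop (𝓝 (S ω)) ∧
      (⊥ < S ω → ∀ᶠ n in atTop, ρ n ω < S ω)) : IsPredictableTime 𝓕 P S := by
  set σ : ℕ → Ω → Set.Iic T := fun n => infTime fun k => ρ (n + k) with hσ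
  have hσs : ∀ n, IsStop 𝓕 (σ n) := fun n => IsStop.infTime hU.1 fun k => hρ _
  have hmono : ∀ ω, Monotone fun n => σ n ω := fun ω =>
    monotone_nat_of_le_succ fun n => le_infTime_iff.2 fun k => by
      have := (le_infTime_iff (ρ := fun k => ρ (n + k)) (ω := ω)).1 le_rfl (k + 1)
      rwa [show n + 1 + k = n + (k + 1) by ring]
  have hle : ∀ n ω, σ n ω ≤ ρ n ω := fun n ω =>
    (le_infTime_iff (ρ := fun k => ρ (n + k)) (ω := ω)).1 le_rfl 0
  have hlim : ∀ᵐ ω ∂P, Tendsto (fun n => σ n ω) atTop (𝓝 (S ω)) := by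
    filter_upwards [h] with ω hω
    refine tendsto_order.2 ⟨fun a ha => ?_, fun a ha => ?_⟩
    · obtain ⟨b, hab, hb⟩ := exists_between ha
      obtain ⟨N, hN⟩ := eventually_atTop.1 (hω.1.eventually_const_lt hb)
      filter_upwards [eventually_ge_atTop N] with n hn
      exact hab.trans_le (le_infTime_iff.2 fun k => (hN _ (by omega)).le)
    · filter_upwards [hω.1.eventually_lt_const ha] with n hn using (hle n ω).trans_lt hn
  refine ⟨isStop_of_tendsto hU hσs (hlim.mono fun ω hω => ⟨hmono ω, hω⟩), σ, hσs, ?_⟩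
  filter_upwards [h, hlim] with ω hω hω'
  refine ⟨hmono ω, hω', fun hpos n => ?_⟩
  obtain ⟨N, hN⟩ := eventually_atTop.1 (hω.2 hpos)
  exact infTime_lt_iff.2 ⟨N, hN _ (by omega)⟩

/-- A time `x` announcing `y`, which equals `y` where `y = 0`, is smaller than every positive time
`z ≥ y`. -/
theorem lt_of_le_of_bot_lt_imp_lt {x y z : Set.Iic T} (hxy : x ≤ y) (hlt : ⊥ < y → x < y)
    (hyz : y ≤ z) (hz : ⊥ < z) : x < z := by
  rcases eq_bot_or_bot_lt y with hy | hy
  · exact (hy ▸ hxy).trans_lt hz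
  · exact (hlt hy).trans_le hyz

theorem IsPredictableTime.min {σ τ : Ω → Set.Iic T} (hσ : IsPredictableTime 𝓕 P σ)
    (hτ : IsPredictableTime 𝓕 P τ) : IsPredictableTime 𝓕 P fun ω => min (σ ω) (τ ω) := by
  obtain ⟨hσs, a, ha, ha'⟩ := hσ
  obtain ⟨hτs, b, hb, hb'⟩ := hτ
  refine ⟨hσs.min hτs, fun n ω => Min.min (a n ω) (b n ω), fun n => (ha n).min (hb n), ?_⟩
  filter_upwards [ha', hb'] with ω h1 h2
  refine ⟨h1.1.min h2.1, h1.2.1.min h2.2.1, fun h n => ?_⟩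
  rw [lt_min_iff] at h
  exact min_lt_min (h1.2.2 h.1 n) (h2.2.2 h.2 n)

theorem IsPredictableTime.max {σ τ : Ω → Set.Iic T} (hσ : IsPredictableTime 𝓕 P σ)
    (hτ : IsPredictableTime 𝓕 P τ) : IsPredictableTime 𝓕 P fun ω => max (σ ω) (τ ω) := by
  obtain ⟨hσs, a, ha, ha'⟩ := hσ
  obtain ⟨hτs, b, hb, hb'⟩ := hτ
  refine ⟨hσs.max hτs, fun n ω => Max.max (a n ω) (b n ω), fun n => (ha n).max (hb n), ?_⟩
  filter_upwards [ha', hb'] with ω h1 h2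
  refine ⟨h1.1.max h2.1, h1.2.1.max h2.2.1, fun h n => max_lt ?_ ?_⟩
  · exact lt_of_le_of_bot_lt_imp_lt (h1.1.ge_of_tendsto h1.2.1 n) (fun h => h1.2.2 h n)
      (le_max_left _ _) h
  · exact lt_of_le_of_bot_lt_imp_lt (h2.1.ge_of_tendsto h2.2.1 n) (fun h => h2.2.2 h n)
      (le_max_right _ _) h

/-- For `h > 0` the time `(σ + h) ∧ T` is predictable, announced by
`(σ + h k / (k + 1)) ∧ (T k / (k + 1))`. -/
theorem isPredictableTime_min_add (hU : UsualConditions 𝓕 P) (hT : 0 < T) {σ : Ω → Set.Iic T}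
    (hσ : IsStop 𝓕 σ) {h : ℝ≥0} (hh : 0 < h) :
    IsPredictableTime 𝓕 P fun ω => ⟨min ((σ ω : ℝ≥0) + h) T, Set.mem_Iic.2 (min_le_right _ _)⟩ := by
  set c : ℕ → ℝ≥0 := fun k => (k : ℝ≥0) / (k + 1) with hc
  have hc1 : ∀ k, c k < 1 := fun k => by
    rw [hc]
    simp only
    rw [div_lt_one (by positivity)]
    exact lt_add_one _
  have hclim : Tendsto c atTop (𝓝 1) := by
    rw [← NNReal.tendsto_coe]
    simpa [hc] using tendsto_natCast_div_add_atTop (1 : ℝ)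
  have hle : ∀ k, T * c k ≤ T := fun k => mul_le_of_le_one_right' (hc1 k).le
  refine isPredictableTime_of_tendsto hU
    (ρ := fun k ω => ⟨min ((σ ω : ℝ≥0) + h * c k) (T * c k),
      Set.mem_Iic.2 ((min_le_right _ _).trans (hle k))⟩)
    (fun k => isStop_iff.2 fun t => ?_) (Eventually.of_forall fun ω => ⟨?_, fun _ => ?_⟩)
  · rw [show {ω | (⟨min ((σ ω : ℝ≥0) + h * c k) (T * c k),
      Set.mem_Iic.2 ((min_le_right _ _).trans (hle k))⟩ :
        Set.Iic T) ≤ t} = {ω | (σ ω : ℝ≥0) + h * c k ≤ t} ∪ {ω | T * c k ≤ t} by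
      ext ω
      simp [← Subtype.coe_le_coe]]
    refine MeasurableSet.union ?_ (MeasurableSet.const _)
    by_cases ht : h * c k ≤ t
    · have hs : (t : ℝ≥0) - h * c k ∈ Set.Iic T := Set.mem_Iic.2 (tsub_le_self.trans t.2)
      have : {ω | (σ ω : ℝ≥0) + h * c k ≤ t} = {ω | σ ω ≤ ⟨(t : ℝ≥0) - h * c k, hs⟩} := by
        ext ω
        simp [← Subtype.coe_le_coe, le_tsub_iff_right ht]
      rw [this]
      exact 𝓕.mono (Subtype.coe_le_coe.1 tsub_le_self) _ (hσ.measurableSet_le _)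
    · have : {ω | (σ ω : ℝ≥0) + h * c k ≤ t} = ∅ := by
        refine Set.eq_empty_of_forall_notMem fun ω hω => ht (le_trans ?_ hω)
        exact le_add_self
      rw [this]
      exact @MeasurableSet.empty _ (𝓕 t)
  · rw [tendsto_subtype_rng]
    have h1 : Tendsto (fun k => (σ ω : ℝ≥0) + h * c k) atTop (𝓝 ((σ ω : ℝ≥0) + h * 1)) :=
      (hclim.const_mul h).const_add _
    have h2 : Tendsto (fun k => T * c k) atTop (𝓝 (T * 1)) := hclim.const_mul T
    simpa using h1.min h2
  · refine Eventually.of_forall fun k => ?_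
    rw [← Subtype.coe_lt_coe]
    exact min_lt_min (add_lt_add_right (mul_lt_of_lt_one_right hh (hc1 k)) _)
      (mul_lt_of_lt_one_right hT (hc1 k))

theorem isPredictableTime_top (hU : UsualConditions 𝓕 P) (hT : 0 < T) :
    IsPredictableTime 𝓕 P fun _ => (⊤ : Set.Iic T) := by
  have h := isPredictableTime_min_add hU hT (σ := fun _ => (⊤ : Set.Iic T))
    (isStop_iff.2 fun t => MeasurableSet.const _) hT
  convert h using 2
  refine Subtype.ext ?_
  exact (min_eq_right (le_add_self)).symm

/-! ### The σ-algebra of events strictly prior to a stopping time -/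

theorem bot_le_sigmaBefore (τ : Ω → Set.Iic T) : 𝓕 ⊥ ≤ sigmaBefore 𝓕 τ := le_sup_left

theorem measurableSet_sigmaBefore_inter (τ : Ω → Set.Iic T) {t : Set.Iic T} {A : Set Ω}
    (hA : MeasurableSet[𝓕 t] A) : MeasurableSet[sigmaBefore 𝓕 τ] (A ∩ {ω | t < τ ω}) :=
  (le_sup_right : _ ≤ sigmaBefore 𝓕 τ) _
    (MeasurableSpace.measurableSet_generateFrom ⟨t, A, hA, rfl⟩)

theorem sigmaBefore_le_iff {τ : Ω → Set.Iic T} {𝒢 : MeasurableSpace Ω} :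
    sigmaBefore 𝓕 τ ≤ 𝒢 ↔ 𝓕 ⊥ ≤ 𝒢 ∧
      ∀ t A, MeasurableSet[𝓕 t] A → MeasurableSet[𝒢] (A ∩ {ω | t < τ ω}) := by
  refine ⟨fun h => ⟨(bot_le_sigmaBefore τ).trans h, fun t A hA =>
    h _ (measurableSet_sigmaBefore_inter τ hA)⟩, fun h => sup_le h.1 ?_⟩
  refine MeasurableSpace.generateFrom_le ?_
  rintro _ ⟨t, A, hA, rfl⟩
  exact h.2 t A hA

theorem sigmaBefore_mono (hU : UsualConditions 𝓕 P) {σ τ : Ω → Set.Iic T} (hσ : IsStop 𝓕 σ)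
    (h : ∀ᵐ ω ∂P, σ ω ≤ τ ω) : sigmaBefore 𝓕 σ ≤ sigmaBefore 𝓕 τ := by
  refine sigmaBefore_le_iff.2 ⟨bot_le_sigmaBefore τ, fun t A hA => ?_⟩
  refine measurableSet_congr_ae hU (bot_le_sigmaBefore τ)
    (measurableSet_sigmaBefore_inter τ (hA.inter (hσ.measurableSet_gt t))) ?_
  filter_upwards [h] with ω hω
  simp only [Set.mem_inter_iff, Set.mem_ofPred_eq]
  exact ⟨fun h => h.1, fun h => ⟨h, h.2.trans_le hω⟩⟩

/-- Events of `ℱ_{σ-}` are known at time `σ`. -/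
theorem measurableSet_inter_le_of_sigmaBefore {σ : Ω → Set.Iic T} (hσ : IsStop 𝓕 σ) {A : Set Ω}
    (hA : MeasurableSet[sigmaBefore 𝓕 σ] A) (t : Set.Iic T) :
    MeasurableSet[𝓕 t] (A ∩ {ω | σ ω ≤ t}) := by
  have h : sigmaBefore 𝓕 σ ≤ IsStoppingTime.measurableSpace hσ := by
    refine sigmaBefore_le_iff.2 ⟨fun A hA => ⟨le_iSup 𝓕 ⊥ _ hA, fun t => ?_⟩,
      fun s A hA => ⟨?_, fun t => ?_⟩⟩
    · exact (𝓕.mono bot_le _ hA).inter (hσ t)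
    · exact le_iSup 𝓕 s _ (hA.inter (hσ.measurableSet_gt s))
    · rcases lt_or_ge s t with hst | hst
      · exact (𝓕.mono hst.le _ (hA.inter (hσ.measurableSet_gt s))).inter (hσ t)
      · have : A ∩ {ω | s < σ ω} ∩ {ω | (σ ω : WithTop (Set.Iic T)) ≤ t} = ∅ := by
          refine Set.eq_empty_of_forall_notMem ?_
          rintro ω ⟨⟨-, h1⟩, h2⟩
          exact absurd (h1.trans_le (WithTop.coe_le_coe.1 h2)) hst.not_gt
        rw [this]
        exact @MeasurableSet.empty _ (𝓕 t)
  simpa using (h A hA).2 t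

/-- Whether `σ < τ` is known strictly before `τ`, for all stopping times `σ`. -/
theorem measurableSet_lt_sigmaBefore {σ τ : Ω → Set.Iic T} (hσ : IsStop 𝓕 σ) :
    MeasurableSet[sigmaBefore 𝓕 τ] {ω | σ ω < τ ω} := by
  obtain ⟨D, hDc, hD⟩ := TopologicalSpace.exists_countable_dense (Set.Iic T)
  have h : {ω | σ ω < τ ω} = ⋃ q ∈ D, {ω | σ ω ≤ q} ∩ {ω | q < τ ω} := by
    ext ω
    simp only [Set.mem_iUnion, Set.mem_inter_iff, Set.mem_ofPred_eq, exists_prop]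
    refine ⟨fun h => ?_, fun ⟨q, _, h1, h2⟩ => h1.trans_lt h2⟩
    obtain ⟨q, hq, h1, h2⟩ := hD.exists_between h
    exact ⟨q, hq, h1.le, h2⟩
  rw [h]
  exact MeasurableSet.biUnion hDc fun q _ =>
    measurableSet_sigmaBefore_inter τ (hσ.measurableSet_le q)

/-- If `τ` is predictable, then whether `σ < τ` is known strictly before `σ`: it means that `σ` is
not after one of the times announcing `τ`. -/
theorem measurableSet_lt_sigmaBefore_left (hU : UsualConditions 𝓕 P) {σ τ : Ω → Set.Iic T}
    (hτ : IsPredictableTime 𝓕 P τ) : MeasurableSet[sigmaBefore 𝓕 σ] {ω | σ ω < τ ω} := by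
  obtain ⟨hτs, a, ha, ha'⟩ := hτ
  refine measurableSet_congr_ae hU (bot_le_sigmaBefore σ)
    (A := {ω | ⊥ < τ ω} ∩ ⋃ n, {ω | a n ω < σ ω}ᶜ) ?_ ?_
  · refine MeasurableSet.inter ?_ (MeasurableSet.iUnion fun n =>
      (measurableSet_lt_sigmaBefore (ha n)).compl)
    exact bot_le_sigmaBefore σ _ (hτs.measurableSet_gt ⊥)
  · filter_upwards [ha'] with ω hω
    simp only [Set.mem_inter_iff, Set.mem_iUnion, Set.mem_compl_iff, Set.mem_ofPred_eq, not_lt]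
    refine ⟨fun ⟨h1, n, hn⟩ => hn.trans_lt (hω.2.2 h1 n), fun h => ⟨bot_le.trans_lt h, ?_⟩⟩
    obtain ⟨n, hn⟩ := (hω.2.1.eventually_const_lt h).exists
    exact ⟨n, hn.le⟩

theorem sigmaBefore_eq_iSup (hU : UsualConditions 𝓕 P) {s : ℕ → Ω → Set.Iic T} {S : Ω → Set.Iic T}
    (hs : ∀ n, IsStop 𝓕 (s n))
    (h : ∀ᵐ ω ∂P, Monotone (fun n => s n ω) ∧ Tendsto (fun n => s n ω) atTop (𝓝 (S ω))) :
    sigmaBefore 𝓕 S = ⨆ n, sigmaBefore 𝓕 (s n) := by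
  have h0 : 𝓕 ⊥ ≤ ⨆ n, sigmaBefore 𝓕 (s n) :=
    (bot_le_sigmaBefore (s 0)).trans (le_iSup (fun n => sigmaBefore 𝓕 (s n)) 0)
  refine le_antisymm (sigmaBefore_le_iff.2 ⟨h0, fun t A hA => ?_⟩) (iSup_le fun n =>
    sigmaBefore_mono hU (hs n) (h.mono fun ω hω => hω.1.ge_of_tendsto hω.2 n))
  refine measurableSet_congr_ae hU h0 (A := ⋃ n, A ∩ {ω | t < s n ω}) (MeasurableSet.iUnion
    fun n => le_iSup (fun n => sigmaBefore 𝓕 (s n)) n _ (measurableSet_sigmaBefore_inter _ hA)) ?_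
  filter_upwards [h] with ω hω
  simp only [Set.mem_iUnion, Set.mem_inter_iff, Set.mem_ofPred_eq]
  refine ⟨fun ⟨n, h1, h2⟩ => ⟨h1, h2.trans_le (hω.1.ge_of_tendsto hω.2 n)⟩, fun ⟨h1, h2⟩ => ?_⟩
  obtain ⟨n, hn⟩ := (hω.2.eventually_const_lt h2).exists
  exact ⟨n, h1, hn⟩

/-- The discrete-time filtration of the events strictly prior to the members of an almost surely
nondecreasing sequence of stopping times. -/
def sigmaBeforeFiltration (hU : UsualConditions 𝓕 P) (s : ℕ → Ω → Set.Iic T)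
    (hs : ∀ n, IsStop 𝓕 (s n)) (h : ∀ᵐ ω ∂P, Monotone (fun n => s n ω)) : Filtration ℕ m where
  seq n := sigmaBefore 𝓕 (s n)
  mono' _ _ hij := sigmaBefore_mono hU (hs _) (h.mono fun _ hω => hω hij)
  le' n := sigmaBefore_le 𝓕 (hs n)

/-- An event of `ℱ_{S-}` is the almost sure limit of events of `ℱ_{s n -}`, if `s n` increases
to `S`: by Lévy's theorem, its conditional probabilities given `ℱ_{s n -}` converge to its
indicator. -/
theorem exists_measurableSet_sigmaBefore_eventually [IsProbabilityMeasure P]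
    (hU : UsualConditions 𝓕 P) {s : ℕ → Ω → Set.Iic T} {S : Ω → Set.Iic T}
    (hs : ∀ n, IsStop 𝓕 (s n))
    (h : ∀ᵐ ω ∂P, Monotone (fun n => s n ω) ∧ Tendsto (fun n => s n ω) atTop (𝓝 (S ω)))
    {A : Set Ω} (hA : MeasurableSet[sigmaBefore 𝓕 S] A) :
    ∃ B : ℕ → Set Ω, (∀ n, MeasurableSet[sigmaBefore 𝓕 (s n)] (B n)) ∧
      ∀ᵐ ω ∂P, ∀ᶠ n in atTop, ω ∈ B n ↔ ω ∈ A := by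
  set 𝒢 := sigmaBeforeFiltration hU s hs (h.mono fun _ hω => hω.1) with h𝒢
  have hsup : (⨆ n, 𝒢 n) = sigmaBefore 𝓕 S := (sigmaBefore_eq_iSup hU hs h).symm
  have hSm : sigmaBefore 𝓕 S ≤ m := hsup ▸ iSup_le fun n => 𝒢.le n
  set g : Ω → ℝ := A.indicator 1 with hg
  have hgm : StronglyMeasurable[sigmaBefore 𝓕 S] g :=
    (@stronglyMeasurable_const _ _ (sigmaBefore 𝓕 S) _ (1 : ℝ)).indicator hA
  have hgi : Integrable g P := (integrable_const (1 : ℝ)).indicator (hSm _ hA)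
  refine ⟨fun n => {ω | (1 / 2 : ℝ) < (P[g | 𝒢 n]) ω}, fun n => ?_, ?_⟩
  · exact measurableSet_lt measurable_const
      (stronglyMeasurable_condExp (m := 𝒢 n) (μ := P) (f := g)).measurable
  · have hc : P[g | sigmaBefore 𝓕 S] = g := condExp_of_stronglyMeasurable hSm hgm hgi
    have := tendsto_ae_condExp (μ := P) (ℱ := 𝒢) g
    rw [hsup, hc] at this
    filter_upwards [this] with ω hω
    by_cases hωA : ω ∈ A
    · have h1 : g ω = 1 := by simp [hg, hωA]
      rw [h1] at hω
      filter_upwards [hω.eventually_const_lt (show (1 / 2 : ℝ) < 1 by norm_num)] with n hn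
      exact iff_of_true hn hωA
    · have h1 : g ω = 0 := by simp [hg, hωA]
      rw [h1] at hω
      filter_upwards [hω.eventually_lt_const (show (0 : ℝ) < 1 / 2 by norm_num)] with n hn
      exact iff_of_false (not_lt.2 hn.le) hωA

/-- Two predictable times not before `S` may be pasted along an event of `ℱ_{S-}`: times announcing
`S`, taken together with approximations of the event known at these times, announce the result. -/
theorem IsPredictableTime.piecewise [IsProbabilityMeasure P] (hU : UsualConditions 𝓕 P)
    {S σ τ : Ω → Set.Iic T} (hS : IsPredictableTime 𝓕 P S) (hσ : IsPredictableTime 𝓕 P σ)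
    (hτ : IsPredictableTime 𝓕 P τ) (hSσ : ∀ᵐ ω ∂P, S ω ≤ σ ω) (hSτ : ∀ᵐ ω ∂P, S ω ≤ τ ω)
    {A : Set Ω} [∀ ω, Decidable (ω ∈ A)] (hA : MeasurableSet[sigmaBefore 𝓕 S] A) :
    IsPredictableTime 𝓕 P fun ω => if ω ∈ A then σ ω else τ ω := by
  classical
  obtain ⟨hSs, s, hs, hs'⟩ := hS
  obtain ⟨hσs, a, ha, ha'⟩ := hσ
  obtain ⟨hτs, b, hb, hb'⟩ := hτ
  obtain ⟨B, hB, hB'⟩ := exists_measurableSet_sigmaBefore_eventually hU hs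
    (hs'.mono fun ω hω => ⟨hω.1, hω.2.1⟩) hA
  refine isPredictableTime_of_tendsto hU
    (ρ := fun n ω => if ω ∈ B n then Max.max (a n ω) (s n ω) else Max.max (b n ω) (s n ω))
    (fun n => isStop_iff.2 fun t => ?_) ?_
  · have hsplit : {ω | (if ω ∈ B n then Max.max (a n ω) (s n ω) else Max.max (b n ω) (s n ω)) ≤ t}
        = (B n ∩ {ω | s n ω ≤ t}) ∩ {ω | a n ω ≤ t} ∪
          ((B n)ᶜ ∩ {ω | s n ω ≤ t}) ∩ {ω | b n ω ≤ t} := by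
      ext ω
      by_cases h : ω ∈ B n <;> simp [h, and_comm]
    rw [hsplit]
    exact ((measurableSet_inter_le_of_sigmaBefore (hs n) (hB n) t).inter
      ((ha n).measurableSet_le t)).union
        ((measurableSet_inter_le_of_sigmaBefore (hs n) (hB n).compl t).inter
          ((hb n).measurableSet_le t))
  · filter_upwards [hs', ha', hb', hB', hSσ, hSτ] with ω h1 h2 h3 h4 h5 h6
    by_cases hωA : ω ∈ A
    · simp only [hωA, if_true, iff_true] at h4 ⊢
      refine ⟨?_, fun hpos => ?_⟩
      · have hlim := h2.2.1.max h1.2.1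
        rw [max_eq_left h5] at hlim
        exact hlim.congr' (h4.mono fun n hn => (if_pos hn).symm)
      · filter_upwards [h4] with n hn
        rw [if_pos hn]
        exact max_lt (h2.2.2 hpos n)
          (lt_of_le_of_bot_lt_imp_lt (h1.1.ge_of_tendsto h1.2.1 n) (fun h => h1.2.2 h n) h5 hpos)
    · simp only [hωA, if_false, iff_false] at h4 ⊢
      refine ⟨?_, fun hpos => ?_⟩
      · have hlim := h3.2.1.max h1.2.1
        rw [max_eq_left h6] at hlim
        exact hlim.congr' (h4.mono fun n hn => (if_neg hn).symm)
      · filter_upwards [h4] with n hn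
        rw [if_neg hn]
        exact max_lt (h3.2.2 hpos n)
          (lt_of_le_of_bot_lt_imp_lt (h1.1.ge_of_tendsto h1.2.1 n) (fun h => h1.2.2 h n) h6 hpos)

/-! ### Predictable times are announced by predictable times -/

/-- The infimum of a sequence is attained if some member is below the limit. -/
theorem exists_infTime_eq {R : ℕ → Ω → Set.Iic T} {ω : Ω} {t : Set.Iic T}
    (hR : Tendsto (fun n => R n ω) atTop (𝓝 t)) (hlt : ∃ n, R n ω < t) :
    ∃ k, infTime R ω = R k ω := by
  obtain ⟨n, hn⟩ := hlt
  obtain ⟨K, hK⟩ := eventually_atTop.1 (hR.eventually_const_lt hn)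
  obtain ⟨k, -, hk⟩ := (Finset.range (K + n + 1)).exists_min_image (fun k => R k ω)
    ⟨n, Finset.mem_range.2 (by omega)⟩
  refine ⟨k, le_antisymm (le_infTime_iff.1 le_rfl k) (le_infTime_iff.2 fun i => ?_)⟩
  by_cases hi : i < K + n + 1
  · exact hk i (Finset.mem_range.2 hi)
  · exact (hk n (Finset.mem_range.2 (by omega))).trans (hK i (by omega)).le

/-- The infimum of a sequence of predictable times `R k` is predictable if it is attained, provided
that the sequence has stopping times `σ k < R k` with the same limit beneath it. -/
theorem isPredictableTime_infTime (hU : UsualConditions 𝓕 P) {R σ : ℕ → Ω → Set.Iic T}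
    {τ : Ω → Set.Iic T} (hR : ∀ k, IsPredictableTime 𝓕 P (R k)) (hσ : ∀ k, IsStop 𝓕 (σ k))
    (h : ∀ᵐ ω ∂P, Tendsto (fun k => R k ω) atTop (𝓝 (τ ω)) ∧
      Tendsto (fun k => σ k ω) atTop (𝓝 (τ ω)) ∧ (∀ k, σ k ω < R k ω) ∧ ∃ k, R k ω < τ ω) :
    IsPredictableTime 𝓕 P (infTime R) := by
  choose a ha ha' using fun k => (hR k).2
  refine isPredictableTime_of_tendsto hU
    (ρ := fun j => infTime fun k ω => if k ≤ j then Max.max (a k j ω) (σ k ω) else ⊤)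
    (fun j => IsStop.infTime hU.1 fun k => ?_) ?_
  · split_ifs
    · exact (ha k j).max (hσ k)
    · exact isStop_iff.2 fun t => MeasurableSet.const _
  · filter_upwards [h, ae_all_iff.2 ha'] with ω hω haω
    obtain ⟨hRτ, hστ, hσR, hex⟩ := hω
    obtain ⟨k, hk⟩ := exists_infTime_eq hRτ hex
    have hlt : ∀ᶠ j in atTop, infTime (fun k ω => if k ≤ j then Max.max (a k j ω) (σ k ω) else ⊤) ω
        < infTime R ω := by
      filter_upwards [eventually_ge_atTop k] with j hj
      refine infTime_lt_iff.2 ⟨k, ?_⟩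
      rw [if_pos hj, hk]
      exact max_lt ((haω k).2.2 (bot_le.trans_lt (hσR k)) j) (hσR k)
    refine ⟨tendsto_order.2 ⟨fun b hb => ?_, fun b hb => hlt.mono fun j hj => hj.trans hb⟩,
      fun _ => hlt⟩
    obtain ⟨c, hbc, hc⟩ := exists_between hb
    have hcR : ∀ k, c < R k ω := fun k => hc.trans_le (le_infTime_iff.1 le_rfl k)
    have hcτ : c < τ ω := by
      obtain ⟨n, hn⟩ := hex
      exact (hcR n).trans hn
    obtain ⟨K, hK⟩ := eventually_atTop.1 (hστ.eventually_const_lt hcτ)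
    have hfin : ∀ᶠ j in atTop, ∀ i ∈ Finset.range K, c < a i j ω :=
      (Finset.eventually_all _).2 fun i _ => (haω i).2.1.eventually_const_lt (hcR i)
    filter_upwards [hfin] with j hj
    refine hbc.trans_le (le_infTime_iff.2 fun i => ?_)
    split_ifs
    · by_cases hi : i < K
      · exact (hj i (Finset.mem_range.2 hi)).le.trans (le_max_left _ _)
      · exact (hK i (not_lt.1 hi)).le.trans (le_max_right _ _)
    · exact le_top

/-- A predictable time `τ > 0` is announced by predictable times. If `σ n` are stopping times that
announce `τ`, then `(σ n + h) ∧ T` is predictable and, for small `h`, is smaller than `τ` outside an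
event of small probability, which is known strictly before that time; there the time is replaced
by `T`, and the tail infima of the resulting sequence announce `τ`. -/
theorem IsPredictableTime.exists_announcing [IsProbabilityMeasure P] (hU : UsualConditions 𝓕 P)
    (hT : 0 < T) {τ : Ω → Set.Iic T} (hτ : IsPredictableTime 𝓕 P τ) (hpos : ∀ᵐ ω ∂P, ⊥ < τ ω) :
    ∃ s : ℕ → PredictableTime 𝓕 P, ∀ᵐ ω ∂P, Monotone (fun n => (s n).1 ω) ∧
      Tendsto (fun n => (s n).1 ω) atTop (𝓝 (τ ω)) ∧ ∀ n, (s n).1 ω < τ ω := by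
  classical
  have hτ' := hτ
  obtain ⟨hτs, σ, hσ, hσ'⟩ := hτ
  set add : ℕ → ℝ≥0 → Ω → Set.Iic T := fun n h ω =>
    ⟨Min.min ((σ n ω : ℝ≥0) + h) T, Set.mem_Iic.2 (min_le_right _ _)⟩ with hadd
  have hadd_pred : ∀ n {h}, 0 < h → IsPredictableTime 𝓕 P (add n h) := fun n h hh =>
    isPredictableTime_min_add hU hT (hσ n) hh
  have hadd_mono : ∀ n ω {h h' : ℝ≥0}, h ≤ h' → add n h ω ≤ add n h' ω := fun n ω h h' hh =>
    Subtype.coe_le_coe.1 (min_le_min_right _ (add_le_add_right hh _))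
  have hadd_lim : ∀ n ω, Tendsto (fun k : ℕ => add n (1 / ((k : ℝ≥0) + 1)) ω) atTop
      (𝓝 (σ n ω)) := fun n ω => by
    rw [tendsto_subtype_rng]
    have h1 : Tendsto (fun k : ℕ => (σ n ω : ℝ≥0) + 1 / ((k : ℝ≥0) + 1)) atTop
        (𝓝 ((σ n ω : ℝ≥0) + 0)) := tendsto_one_div_add_atTop_nhds_zero_nat.const_add _
    have h2 := h1.min (tendsto_const_nhds (x := T))
    rwa [add_zero, min_eq_left (σ n ω).2] at h2
  have hchoose : ∀ n : ℕ, ∃ k : ℕ, n ≤ k ∧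
      P {ω | τ ω ≤ add n (1 / ((k : ℝ≥0) + 1)) ω} ≤ 2⁻¹ ^ n := fun n => by
    have hlim : Tendsto (fun k : ℕ => P {ω | τ ω ≤ add n (1 / ((k : ℝ≥0) + 1)) ω}) atTop
        (𝓝 (P (⋂ k : ℕ, {ω | τ ω ≤ add n (1 / ((k : ℝ≥0) + 1)) ω}))) := by
      refine tendsto_measure_iInter_atTop (fun k => ?_) (fun i j hij ω hω => ?_)
        ⟨0, measure_ne_top _ _⟩
      · exact (measurableSet_le hτs.measurable
          (hadd_pred n (by positivity)).1.measurable).nullMeasurableSet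
      · refine le_trans (show τ ω ≤ _ from hω) (hadd_mono n ω ?_)
        have hij' : (i : ℝ≥0) ≤ j := by exact_mod_cast hij
        gcongr
    have hzero : P (⋂ k : ℕ, {ω | τ ω ≤ add n (1 / ((k : ℝ≥0) + 1)) ω}) = 0 := by
      refine measure_mono_null (t := {ω | ¬ σ n ω < τ ω}) (fun ω hω => ?_) ?_
      · exact not_lt.2 (ge_of_tendsto' (hadd_lim n ω) fun k => Set.mem_iInter.1 hω k)
      · refine ae_iff.1 ?_
        filter_upwards [hσ', hpos] with ω h1 h2 using h1.2.2 h2 n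
    rw [hzero] at hlim
    have hp : (0 : ℝ≥0∞) < 2⁻¹ ^ n := ENNReal.pow_pos (by simp) n
    obtain ⟨k, hk1, hk2⟩ := ((eventually_ge_atTop n).and (hlim.eventually_lt_const hp)).exists
    exact ⟨k, hk1, hk2.le⟩
  choose k hkn hk using hchoose
  set u : ℕ → Ω → Set.Iic T := fun n => add n (1 / ((k n : ℝ≥0) + 1)) with hu
  have hu_pred : ∀ n, IsPredictableTime 𝓕 P (u n) := fun n => hadd_pred n (by positivity)
  set R : ℕ → Ω → Set.Iic T := fun n ω => if ω ∈ {ω | u n ω < τ ω} then u n ω else ⊤ with hRdef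
  have hR : ∀ n, IsPredictableTime 𝓕 P (R n) := fun n =>
    IsPredictableTime.piecewise hU (hu_pred n) (hu_pred n) (isPredictableTime_top hU hT)
      (ae_of_all _ fun _ => le_rfl) (ae_of_all _ fun _ => le_top)
      (measurableSet_lt_sigmaBefore_left hU hτ')
  have hBC : ∀ᵐ ω ∂P, ∀ᶠ n in atTop, u n ω < τ ω := by
    have hsum : ∑' n, P {ω | τ ω ≤ u n ω} ≠ ∞ :=
      ne_top_of_le_ne_top (by rw [ENNReal.tsum_geometric_two]; simp) (ENNReal.tsum_le_tsum hk)
    filter_upwards [ae_eventually_notMem hsum] with ω hω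
    filter_upwards [hω] with n hn using not_le.1 hn
  have hall : ∀ᵐ ω ∂P, Tendsto (fun k => R k ω) atTop (𝓝 (τ ω)) ∧
      Tendsto (fun k => σ k ω) atTop (𝓝 (τ ω)) ∧ (∀ k, σ k ω < R k ω) ∧
      ∀ᶠ k in atTop, R k ω < τ ω := by
    filter_upwards [hBC, hσ', hpos] with ω h1 h2 h3
    have hRu : ∀ᶠ n in atTop, R n ω = u n ω := h1.mono fun n hn => if_pos hn
    refine ⟨Tendsto.congr' (hRu.mono fun _ h => h.symm) ?_, h2.2.1, fun n => ?_, ?_⟩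
    · rw [tendsto_subtype_rng]
      have hσR : Tendsto (fun n => (σ n ω : ℝ≥0)) atTop (𝓝 (τ ω : ℝ≥0)) :=
        tendsto_subtype_rng.1 h2.2.1
      have hup : Tendsto (fun n => (σ n ω : ℝ≥0) + 1 / ((n : ℝ≥0) + 1)) atTop
          (𝓝 ((τ ω : ℝ≥0) + 0)) := hσR.add tendsto_one_div_add_atTop_nhds_zero_nat
      rw [add_zero] at hup
      refine tendsto_of_tendsto_of_tendsto_of_le_of_le hσR hup (fun n => ?_) fun n => ?_
      · exact le_min le_self_add (σ n ω).2
      · have hkn' : (n : ℝ≥0) ≤ k n := by exact_mod_cast hkn n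
        refine (min_le_left _ _).trans (add_le_add_right ?_ _)
        gcongr
    · have hlt : σ n ω < τ ω := h2.2.2 h3 n
      simp only [hRdef]
      split_ifs
      · rw [← Subtype.coe_lt_coe]
        exact lt_min (lt_add_of_pos_right _ (by positivity))
          ((Subtype.coe_lt_coe.2 hlt).trans_le (τ ω).2)
      · exact hlt.trans_le le_top
    · filter_upwards [h1, hRu] with n hn hn'
      rwa [hn']
  have hshift : ∀ n, ∀ᵐ ω ∂P, Tendsto (fun k => R (n + k) ω) atTop (𝓝 (τ ω)) ∧
      Tendsto (fun k => σ (n + k) ω) atTop (𝓝 (τ ω)) ∧ (∀ k, σ (n + k) ω < R (n + k) ω) ∧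
      ∃ k, R (n + k) ω < τ ω := fun n => by
    have hn : Tendsto (fun k => n + k) atTop atTop :=
      tendsto_atTop_mono (fun k => Nat.le_add_left k n) tendsto_id
    filter_upwards [hall] with ω hω
    exact ⟨hω.1.comp hn, hω.2.1.comp hn, fun k => hω.2.2.1 _, (hn.eventually hω.2.2.2).exists⟩
  refine ⟨fun n => ⟨infTime fun k => R (n + k),
    isPredictableTime_infTime hU (fun k => hR _) (fun k => hσ _) (hshift n)⟩, ?_⟩
  filter_upwards [ae_all_iff.2 hshift, hall, hσ'] with ω h1 h2 h3
  have hle : ∀ n i, infTime (fun k => R (n + k)) ω ≤ R (n + i) ω := fun n i =>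
    (le_infTime_iff (ρ := fun k => R (n + k)) (ω := ω)).1 le_rfl i
  refine ⟨monotone_nat_of_le_succ fun n => le_infTime_iff.2 fun i => ?_, ?_, fun n => ?_⟩
  · rw [show n + 1 + i = n + (i + 1) by ring]
    exact hle n (i + 1)
  · refine tendsto_of_tendsto_of_tendsto_of_le_of_le h3.2.1 h2.1 (fun n => ?_) (fun n => hle n 0)
    exact le_infTime_iff.2 fun i => (h3.1 (Nat.le_add_right n i)).trans (h2.2.2.1 _).le
  · exact infTime_lt_iff.2 (h1 n).2.2.2

/-! ### The predictable value function as a supermartingale -/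

theorem IsAdmissible.measurable {φ : PredictableTime 𝓕 P → Ω → ℝ≥0∞} (hφ : IsAdmissible 𝓕 P φ)
    (σ : PredictableTime 𝓕 P) : Measurable (φ σ) :=
  (hφ.1 σ).mono (sigmaBefore_le 𝓕 σ.2.1) le_rfl

section ValueFunction

variable {φ : PredictableTime 𝓕 P → Ω → ℝ≥0∞}

theorem measurable_valueFunction (S : PredictableTime 𝓕 P) :
    Measurable[sigmaBefore 𝓕 S.1] (valueFunction 𝓕 P φ S) :=
  measurable_essSupFamily P _ _ fun _ => measurable_condLExp _ _ _

theorem measurable_valueFunction' (S : PredictableTime 𝓕 P) :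
    Measurable (valueFunction 𝓕 P φ S) :=
  (measurable_valueFunction S).mono (sigmaBefore_le 𝓕 S.2.1) le_rfl

/-- If `S ≤ S'`, the traces on `{S = S'}` of the σ-algebras before `S` and before `S'` agree. -/
theorem measurableSet_sigmaBefore_inter_eq (hU : UsualConditions 𝓕 P) {S S' : PredictableTime 𝓕 P}
    (h : ∀ᵐ ω ∂P, S.1 ω ≤ S'.1 ω) {C : Set Ω} (hC : MeasurableSet[sigmaBefore 𝓕 S'.1] C) :
    MeasurableSet[sigmaBefore 𝓕 S.1] (C ∩ {ω | S.1 ω < S'.1 ω}ᶜ) := by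
  set A : Set Ω := {ω | S.1 ω < S'.1 ω}ᶜ with hAdef
  have hA : MeasurableSet[sigmaBefore 𝓕 S.1] A :=
    (measurableSet_lt_sigmaBefore_left hU S'.2).compl
  set 𝒢 : MeasurableSpace Ω :=
    ((sigmaBefore 𝓕 S.1).comap (Subtype.val : A → Ω)).map Subtype.val with h𝒢
  have h𝒢_iff : ∀ C, MeasurableSet[𝒢] C ↔ MeasurableSet[sigmaBefore 𝓕 S.1] (C ∩ A) := by
    intro C
    constructor
    · rintro ⟨D, hD, hDC⟩
      have : C ∩ A = D ∩ A := by
        rw [Set.inter_comm C, Set.inter_comm D]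
        exact (Subtype.preimage_val_eq_preimage_val_iff _ _ _).1 hDC.symm
      rw [this]
      exact hD.inter hA
    · intro hCA
      exact ⟨C ∩ A, hCA, by ext; simp⟩
  refine (h𝒢_iff C).1 ((sigmaBefore_le_iff.2 ⟨fun B hB => ?_, fun t B hB => ?_⟩ :
    sigmaBefore 𝓕 S'.1 ≤ 𝒢) C hC)
  · exact (h𝒢_iff B).2 ((bot_le_sigmaBefore S.1 _ hB).inter hA)
  · refine (h𝒢_iff _).2 (measurableSet_congr_ae hU (bot_le_sigmaBefore S.1)
      ((measurableSet_sigmaBefore_inter S.1 hB).inter hA) ?_)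
    filter_upwards [h] with ω hω
    simp only [hAdef, Set.mem_inter_iff, Set.mem_compl_iff, Set.mem_ofPred_eq, not_lt]
    refine and_congr_left fun h' => ?_
    rw [le_antisymm hω h']

variable [IsProbabilityMeasure P]

theorem setLIntegral_condLExp_sigmaBefore (S : PredictableTime 𝓕 P) (X : Ω → ℝ≥0∞) {A : Set Ω}
    (hA : MeasurableSet[sigmaBefore 𝓕 S.1] A) :
    ∫⁻ ω in A, condLExp (sigmaBefore 𝓕 S.1) P X ω ∂P = ∫⁻ ω in A, X ω ∂P :=
  setLIntegral_condLExp (sigmaBefore_le 𝓕 S.2.1) P X hA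

theorem condLExp_le_valueFunction {S σ : PredictableTime 𝓕 P} (h : ∀ᵐ ω ∂P, S.1 ω ≤ σ.1 ω) :
    condLExp (sigmaBefore 𝓕 S.1) P (φ σ) ≤ᵐ[P] valueFunction 𝓕 P φ S :=
  le_essSupFamily P (fun τ : {τ : PredictableTime 𝓕 P // ∀ᵐ ω ∂P, S.1 ω ≤ τ.1 ω} =>
    condLExp (sigmaBefore 𝓕 S.1) P (φ τ.1)) (fun _ => measurable_condLExp' _ _ _) ⟨σ, h⟩

theorem le_valueFunction (hφ : IsAdmissible 𝓕 P φ) (S : PredictableTime 𝓕 P) :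
    φ S ≤ᵐ[P] valueFunction 𝓕 P φ S := by
  have h := condLExp_le_valueFunction (φ := φ) (S := S) (σ := S) (ae_of_all _ fun _ => le_rfl)
  rwa [condLExp_eq_self (sigmaBefore_le 𝓕 S.2.1) P (hφ.1 S)] at h

/-- The family of the conditional expectations defining the value function is directed upwards. -/
theorem exists_condLExp_eq_max (hU : UsualConditions 𝓕 P) (hφ : IsAdmissible 𝓕 P φ)
    {S σ τ : PredictableTime 𝓕 P} (hσ : ∀ᵐ ω ∂P, S.1 ω ≤ σ.1 ω) (hτ : ∀ᵐ ω ∂P, S.1 ω ≤ τ.1 ω) :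
    ∃ ρ : PredictableTime 𝓕 P, (∀ᵐ ω ∂P, S.1 ω ≤ ρ.1 ω) ∧
      condLExp (sigmaBefore 𝓕 S.1) P (φ ρ) =ᵐ[P] fun ω =>
        max (condLExp (sigmaBefore 𝓕 S.1) P (φ σ) ω) (condLExp (sigmaBefore 𝓕 S.1) P (φ τ) ω) := by
  classical
  set f := condLExp (sigmaBefore 𝓕 S.1) P (φ σ) with hf
  set g := condLExp (sigmaBefore 𝓕 S.1) P (φ τ) with hg
  have hSm := sigmaBefore_le 𝓕 S.2.1
  have hfm : Measurable[sigmaBefore 𝓕 S.1] f := measurable_condLExp _ _ _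
  have hgm : Measurable[sigmaBefore 𝓕 S.1] g := measurable_condLExp _ _ _
  set A : Set Ω := {ω | g ω ≤ f ω} with hAdef
  have hA : MeasurableSet[sigmaBefore 𝓕 S.1] A :=
    @measurableSet_le _ _ _ _ _ (sigmaBefore 𝓕 S.1) _ _ _ _ _ hgm hfm
  set ρ : PredictableTime 𝓕 P := ⟨fun ω => if ω ∈ A then σ.1 ω else τ.1 ω,
    S.2.piecewise hU σ.2 τ.2 hσ hτ hA⟩ with hρ
  refine ⟨ρ, ?_, ?_⟩
  · filter_upwards [hσ, hτ] with ω h1 h2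
    simp only [hρ]
    split_ifs
    exacts [h1, h2]
  · refine (ae_eq_condLExp hSm P _ (hfm.max hgm)
      fun s hs => ?_).symm
    rw [← lintegral_inter_add_sdiff _ s (hSm _ hA), ← lintegral_inter_add_sdiff (φ ρ) s (hSm _ hA)]
    have h1 : ∫⁻ ω in s ∩ A, max (f ω) (g ω) ∂P = ∫⁻ ω in s ∩ A, φ ρ ω ∂P := by
      rw [setLIntegral_congr_fun (hSm _ (hs.inter hA)) fun ω hω => max_eq_left hω.2,
        setLIntegral_condLExp_sigmaBefore S _ (hs.inter hA)]
      refine setLIntegral_congr_fun_ae (hSm _ (hs.inter hA)) ?_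
      filter_upwards [hφ.2 σ ρ] with ω hω hωA
      exact hω (by simp only [hρ]; rw [if_pos hωA.2])
    have hsA : MeasurableSet[sigmaBefore 𝓕 S.1] (s \ A) := MeasurableSet.diff hs hA
    have h2 : ∫⁻ ω in s \ A, max (f ω) (g ω) ∂P = ∫⁻ ω in s \ A, φ ρ ω ∂P := by
      rw [setLIntegral_congr_fun (hSm _ hsA) fun ω hω => max_eq_right (not_le.1 hω.2).le,
        setLIntegral_condLExp_sigmaBefore S _ hsA]
      refine setLIntegral_congr_fun_ae (hSm _ hsA) ?_
      filter_upwards [hφ.2 τ ρ] with ω hω hωA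
      exact hω (by simp only [hρ]; rw [if_neg hωA.2])
    rw [h1, h2]

/-- Since the family is directed, its essential supremum is the limit of a nondecreasing sequence of
its members. -/
theorem exists_seq_valueFunction_eq_iSup (hU : UsualConditions 𝓕 P) (hφ : IsAdmissible 𝓕 P φ)
    (S : PredictableTime 𝓕 P) : ∃ σ : ℕ → PredictableTime 𝓕 P,
      (∀ k, ∀ᵐ ω ∂P, S.1 ω ≤ (σ k).1 ω) ∧
      (∀ᵐ ω ∂P, Monotone fun k => condLExp (sigmaBefore 𝓕 S.1) P (φ (σ k)) ω) ∧
      ∀ᵐ ω ∂P, valueFunction 𝓕 P φ S ω = ⨆ k, condLExp (sigmaBefore 𝓕 S.1) P (φ (σ k)) ω := by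
  set I := {τ : PredictableTime 𝓕 P // ∀ᵐ ω ∂P, S.1 ω ≤ τ.1 ω} with hI
  set f : I → Ω → ℝ≥0∞ := fun τ => condLExp (sigmaBefore 𝓕 S.1) P (φ τ.1) with hf
  obtain ⟨s, hsc, hs⟩ := exists_countable_ae_le_iSup P f fun _ => measurable_condLExp' _ _ _
  obtain ⟨g, hg⟩ := (hsc.insert ⟨S, ae_of_all _ fun _ => le_rfl⟩).exists_eq_range
    (Set.insert_nonempty _ _)
  have hmax : ∀ i j : I, ∃ k : I, f k =ᵐ[P] fun ω => max (f i ω) (f j ω) := fun i j => by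
    obtain ⟨ρ, hρ1, hρ2⟩ := exists_condLExp_eq_max hU hφ i.2 j.2
    exact ⟨⟨ρ, hρ1⟩, hρ2⟩
  choose M hM using hmax
  let σ : ℕ → I := fun n => Nat.rec (g 0) (fun k i => M i (g (k + 1))) n
  have hσ : ∀ k, f (σ (k + 1)) =ᵐ[P] fun ω => max (f (σ k) ω) (f (g (k + 1)) ω) := fun k =>
    hM (σ k) (g (k + 1))
  have hσV : ∀ k, f (σ k) ≤ᵐ[P] valueFunction 𝓕 P φ S := fun k =>
    condLExp_le_valueFunction (σ k).2
  have hVg : valueFunction 𝓕 P φ S ≤ᵐ[P] fun ω => ⨆ k, f (g k) ω := by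
    refine essSupFamily_le P f _ fun i => (hs i).mono fun ω hω => hω.trans ?_
    refine iSup₂_le fun j hj => ?_
    obtain ⟨k, hk⟩ : j ∈ Set.range g := hg ▸ Set.mem_insert_of_mem _ hj
    exact hk ▸ le_iSup (fun k => f (g k) ω) k
  refine ⟨fun k => (σ k).1, fun k => (σ k).2, ?_, ?_⟩
  · filter_upwards [ae_all_iff.2 hσ] with ω hω
    exact monotone_nat_of_le_succ fun k => (le_max_left _ _).trans (hω k).ge
  · filter_upwards [ae_all_iff.2 hσ, ae_all_iff.2 hσV, hVg] with ω h1 h2 h3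
    refine le_antisymm (h3.trans (iSup_mono fun k => ?_)) (iSup_le h2)
    rcases k with _ | k
    · exact le_rfl
    · exact (le_max_right _ _).trans (h1 k).ge

/-- On an event of `ℱ_{S-}` the expectation of the value function is the supremum of the expected
rewards. -/
theorem setLIntegral_valueFunction_le (hU : UsualConditions 𝓕 P) (hφ : IsAdmissible 𝓕 P φ)
    {S : PredictableTime 𝓕 P} {A : Set Ω} (hA : MeasurableSet[sigmaBefore 𝓕 S.1] A) {c : ℝ≥0∞}
    (hc : ∀ σ : PredictableTime 𝓕 P, (∀ᵐ ω ∂P, S.1 ω ≤ σ.1 ω) → ∫⁻ ω in A, φ σ ω ∂P ≤ c) :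
    ∫⁻ ω in A, valueFunction 𝓕 P φ S ω ∂P ≤ c := by
  obtain ⟨σ, hσ, hmono, hsup⟩ := exists_seq_valueFunction_eq_iSup hU hφ S
  rw [lintegral_congr_ae (ae_restrict_of_ae hsup), lintegral_iSup'
    (fun k => (measurable_condLExp' _ _ _).aemeasurable) (ae_restrict_of_ae hmono)]
  refine iSup_le fun k => ?_
  rw [setLIntegral_condLExp_sigmaBefore S _ hA]
  exact hc (σ k) (hσ k)

theorem setLIntegral_le_valueFunction {S σ : PredictableTime 𝓕 P}
    (hσ : ∀ᵐ ω ∂P, S.1 ω ≤ σ.1 ω) {A : Set Ω} (hA : MeasurableSet[sigmaBefore 𝓕 S.1] A) :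
    ∫⁻ ω in A, φ σ ω ∂P ≤ ∫⁻ ω in A, valueFunction 𝓕 P φ S ω ∂P := by
  rw [← setLIntegral_condLExp_sigmaBefore S _ hA]
  exact lintegral_mono_ae (ae_restrict_of_ae (condLExp_le_valueFunction hσ))

/-- The supermartingale property of the value function. -/
theorem setLIntegral_valueFunction_anti (hU : UsualConditions 𝓕 P) (hφ : IsAdmissible 𝓕 P φ)
    {S S' : PredictableTime 𝓕 P} (h : ∀ᵐ ω ∂P, S.1 ω ≤ S'.1 ω) {A : Set Ω}
    (hA : MeasurableSet[sigmaBefore 𝓕 S.1] A) :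
    ∫⁻ ω in A, valueFunction 𝓕 P φ S' ω ∂P ≤ ∫⁻ ω in A, valueFunction 𝓕 P φ S ω ∂P := by
  refine setLIntegral_valueFunction_le hU hφ (sigmaBefore_mono hU S.2.1 h _ hA) fun σ hσ => ?_
  refine setLIntegral_le_valueFunction ?_ hA
  filter_upwards [h, hσ] with ω h1 h2 using h1.trans h2

theorem lintegral_valueFunction_anti (hU : UsualConditions 𝓕 P) (hφ : IsAdmissible 𝓕 P φ)
    {S S' : PredictableTime 𝓕 P} (h : ∀ᵐ ω ∂P, S.1 ω ≤ S'.1 ω) :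
    ∫⁻ ω, valueFunction 𝓕 P φ S' ω ∂P ≤ ∫⁻ ω, valueFunction 𝓕 P φ S ω ∂P := by
  simpa using setLIntegral_valueFunction_anti hU hφ h
    (@MeasurableSet.univ _ (sigmaBefore 𝓕 S.1))

theorem lintegral_valueFunction_le_iSup (hU : UsualConditions 𝓕 P) (hφ : IsAdmissible 𝓕 P φ)
    (S : PredictableTime 𝓕 P) :
    ∫⁻ ω, valueFunction 𝓕 P φ S ω ∂P ≤ ⨆ τ, ∫⁻ ω, φ τ ω ∂P := by
  have := setLIntegral_valueFunction_le hU hφ (S := S) (c := ⨆ τ, ∫⁻ ω, φ τ ω ∂P)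
    (@MeasurableSet.univ _ (sigmaBefore 𝓕 S.1)) fun σ _ => by
      rw [setLIntegral_univ]
      exact le_iSup (fun τ => ∫⁻ ω, φ τ ω ∂P) σ
  simpa using this

theorem exists_lintegral_valueFunction_le_add (hU : UsualConditions 𝓕 P)
    (hφ : IsAdmissible 𝓕 P φ) (hφ_sup : (⨆ τ, ∫⁻ ω, φ τ ω ∂P) < ∞) (S : PredictableTime 𝓕 P)
    {δ : ℝ≥0∞} (hδ : δ ≠ 0) : ∃ σ : PredictableTime 𝓕 P, (∀ᵐ ω ∂P, S.1 ω ≤ σ.1 ω) ∧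
      ∫⁻ ω, valueFunction 𝓕 P φ S ω ∂P ≤ ∫⁻ ω, φ σ ω ∂P + δ := by
  set v := ∫⁻ ω, valueFunction 𝓕 P φ S ω ∂P with hv
  have hvt : v ≠ ∞ := ((lintegral_valueFunction_le_iSup hU hφ S).trans_lt hφ_sup).ne
  by_contra! hcon
  have hv0 : v ≠ 0 := by
    have := hcon S (ae_of_all _ fun _ => le_rfl)
    exact (bot_le.trans_lt this).ne'
  have hle : v ≤ v - δ := by
    have := setLIntegral_valueFunction_le hU hφ (S := S) (c := v - δ)
      (@MeasurableSet.univ _ (sigmaBefore 𝓕 S.1)) fun σ hσ => by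
        rw [setLIntegral_univ]
        have hlt := hcon σ hσ
        have hδt : δ ≠ ∞ := ne_top_of_le_ne_top hvt (le_add_self.trans hlt.le)
        exact (ENNReal.le_sub_of_add_le_right hδt hlt.le)
    simpa using this
  exact absurd (ENNReal.sub_lt_self hvt hv0 hδ) hle.not_gt

/-- On `{S = S'}` every conditional expectation in the definition of `V_p(S')` is also one in the
definition of `V_p(S)`, because the σ-algebras have the same trace there. -/
theorem valueFunction_le_of_eq (hU : UsualConditions 𝓕 P) {S S' : PredictableTime 𝓕 P}
    (h : ∀ᵐ ω ∂P, S.1 ω ≤ S'.1 ω) :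
    ∀ᵐ ω ∂P, S.1 ω = S'.1 ω → valueFunction 𝓕 P φ S' ω ≤ valueFunction 𝓕 P φ S ω := by
  classical
  set A : Set Ω := {ω | S.1 ω < S'.1 ω}ᶜ with hAdef
  have hSm := sigmaBefore_le 𝓕 S.2.1
  have hA : MeasurableSet[sigmaBefore 𝓕 S.1] A :=
    (measurableSet_lt_sigmaBefore_left hU S'.2).compl
  have hAS' : MeasurableSet[sigmaBefore 𝓕 S'.1] A := sigmaBefore_mono hU S.2.1 h _ hA
  have key : valueFunction 𝓕 P φ S' ≤ᵐ[P] fun ω =>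
      if ω ∈ A then valueFunction 𝓕 P φ S ω else ∞ := by
    refine essSupFamily_le P _ _ ?_
    rintro ⟨σ, hσ⟩
    set f := condLExp (sigmaBefore 𝓕 S.1) P (φ σ) with hf
    set f' := condLExp (sigmaBefore 𝓕 S'.1) P (φ σ) with hf'
    have hfm : Measurable[sigmaBefore 𝓕 S.1] f := measurable_condLExp _ _ _
    have hfm' : Measurable[sigmaBefore 𝓕 S'.1] f' := measurable_condLExp _ _ _
    have hY' : Measurable[sigmaBefore 𝓕 S.1] (A.indicator f') := by
      intro B hB
      rw [Set.indicator_preimage]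
      exact (measurableSet_sigmaBefore_inter_eq hU h (hfm' hB)).union
        (MeasurableSet.diff ((measurable_const :
          Measurable[sigmaBefore 𝓕 S.1] (0 : Ω → ℝ≥0∞)) hB) hA)
    have hY : Measurable[sigmaBefore 𝓕 S.1] (A.indicator f) := hfm.indicator hA
    have e1 : A.indicator f =ᵐ[P] condLExp (sigmaBefore 𝓕 S.1) P (A.indicator (φ σ)) := by
      refine ae_eq_condLExp hSm P _ hY fun s hs => ?_
      rw [setLIntegral_indicator (hSm _ hA), setLIntegral_indicator (hSm _ hA),
        setLIntegral_condLExp_sigmaBefore S _ (hA.inter hs)]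
    have e2 : A.indicator f' =ᵐ[P] condLExp (sigmaBefore 𝓕 S.1) P (A.indicator (φ σ)) := by
      refine ae_eq_condLExp hSm P _ hY' fun s hs => ?_
      rw [setLIntegral_indicator (hSm _ hA), setLIntegral_indicator (hSm _ hA),
        setLIntegral_condLExp_sigmaBefore S' _ (hAS'.inter (sigmaBefore_mono hU S.2.1 h _ hs))]
    have hSσ : ∀ᵐ ω ∂P, S.1 ω ≤ σ.1 ω := by
      filter_upwards [h, hσ] with ω h1 h2 using h1.trans h2
    filter_upwards [e1, e2, condLExp_le_valueFunction (φ := φ) hSσ] with ω h1 h2 h3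
    split_ifs with hω
    · rw [← h1, Set.indicator_of_mem hω, Set.indicator_of_mem hω] at h2
      exact h2.trans_le h3
    · exact le_top
  filter_upwards [key] with ω hω heq
  have hωA : ω ∈ A := by simp [hAdef, heq]
  rwa [if_pos hωA] at hω

/-- Supermartingale convergence: the value function converges along nondecreasing sequences. -/
theorem exists_tendsto_valueFunction (hU : UsualConditions 𝓕 P) (hφ : IsAdmissible 𝓕 P φ)
    (hφ_sup : (⨆ τ, ∫⁻ ω, φ τ ω ∂P) < ∞) (s : ℕ → PredictableTime 𝓕 P)
    (hs : ∀ᵐ ω ∂P, Monotone fun n => (s n).1 ω) :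
    ∀ᵐ ω ∂P, ∃ l : ℝ≥0∞, Tendsto (fun n => valueFunction 𝓕 P φ (s n) ω) atTop (𝓝 l) := by
  set V : ℕ → Ω → ℝ≥0∞ := fun n => valueFunction 𝓕 P φ (s n) with hV
  set 𝒢 := sigmaBeforeFiltration hU (fun n => (s n).1) (fun n => (s n).2.1) hs with h𝒢
  have hM : ∀ n, ∫⁻ ω, V n ω ∂P ≤ ⨆ τ, ∫⁻ ω, φ τ ω ∂P := fun n =>
    lintegral_valueFunction_le_iSup hU hφ (s n)
  have hMt : ∀ n, ∫⁻ ω, V n ω ∂P ≠ ∞ := fun n => ((hM n).trans_lt hφ_sup).ne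
  have hVm : ∀ n, Measurable (V n) := fun n => measurable_valueFunction' (s n)
  have hVfin : ∀ n, ∀ᵐ ω ∂P, V n ω < ∞ := fun n => ae_lt_top (hVm n) (hMt n)
  have hint : ∀ n, Integrable (fun ω => -(V n ω).toReal) P := fun n =>
    (integrable_toReal_of_lintegral_ne_top (hVm n).aemeasurable (hMt n)).neg
  have hsub : Submartingale (fun n ω => -(V n ω).toReal) 𝒢 P := by
    refine submartingale_of_setIntegral_le (fun n => ?_) hint fun i j hij A hA => ?_
    · exact (measurable_valueFunction (φ := φ) (s n)).ennreal_toReal.stronglyMeasurable.neg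
    · rw [integral_neg, integral_neg, neg_le_neg_iff,
        integral_toReal (hVm j).aemeasurable (ae_restrict_of_ae (hVfin j)),
        integral_toReal (hVm i).aemeasurable (ae_restrict_of_ae (hVfin i))]
      refine ENNReal.toReal_mono
        (ne_top_of_le_ne_top (hMt i) (setLIntegral_le_lintegral _ _)) ?_
      exact setLIntegral_valueFunction_anti hU hφ (hs.mono fun ω hω => hω hij) hA
  have hbdd : ∀ n, eLpNorm (fun ω => -(V n ω).toReal) 1 P ≤
      ((⨆ τ, ∫⁻ ω, φ τ ω ∂P).toNNReal : ℝ≥0∞) := fun n => by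
    rw [ENNReal.coe_toNNReal hφ_sup.ne, eLpNorm_one_eq_lintegral_enorm]
    refine (lintegral_mono fun ω => ?_).trans (hM n)
    rw [enorm_neg, Real.enorm_eq_ofReal ENNReal.toReal_nonneg]
    exact ENNReal.ofReal_toReal_le
  filter_upwards [hsub.ae_tendsto_limitProcess hbdd, ae_all_iff.2 hVfin] with ω hω hfin
  refine ⟨_, (ENNReal.tendsto_ofReal hω.neg).congr fun n => ?_⟩
  rw [neg_neg, ENNReal.ofReal_toReal (hfin n).ne]

/-- Lévy's upward theorem for the σ-algebras prior to times that increase to `τ`. -/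
theorem tendsto_condLExp_sigmaBefore (hU : UsualConditions 𝓕 P) {s : ℕ → PredictableTime 𝓕 P}
    {τ : PredictableTime 𝓕 P}
    (hs : ∀ᵐ ω ∂P, Monotone (fun n => (s n).1 ω) ∧
      Tendsto (fun n => (s n).1 ω) atTop (𝓝 (τ.1 ω)))
    {X : Ω → ℝ≥0∞} (hXm : Measurable X) (hX : ∫⁻ ω, X ω ∂P ≠ ∞) :
    ∀ᵐ ω ∂P, Tendsto (fun n => condLExp (sigmaBefore 𝓕 (s n).1) P X ω) atTop
      (𝓝 (condLExp (sigmaBefore 𝓕 τ.1) P X ω)) := by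
  set 𝒢 := sigmaBeforeFiltration hU (fun n => (s n).1) (fun n => (s n).2.1)
    (hs.mono fun _ h => h.1) with h𝒢
  have hsup : (⨆ n, 𝒢 n) = sigmaBefore 𝓕 τ.1 :=
    (sigmaBefore_eq_iSup hU (fun n => (s n).2.1) hs).symm
  have h1 := tendsto_ae_condExp (μ := P) (ℱ := 𝒢) fun ω => (X ω).toReal
  rw [hsup] at h1
  have h2 := fun n => toReal_condLExp (μ := P) (sigmaBefore 𝓕 (s n).1) hXm.aemeasurable hX
  have h3 := toReal_condLExp (μ := P) (sigmaBefore 𝓕 τ.1) hXm.aemeasurable hX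
  have h4 : ∀ n, ∀ᵐ ω ∂P, condLExp (sigmaBefore 𝓕 (s n).1) P X ω ≠ ∞ := fun n => condLExp_ne_top hX
  filter_upwards [h1, ae_all_iff.2 h2, h3, ae_all_iff.2 h4,
    condLExp_ne_top (mΩ := sigmaBefore 𝓕 τ.1) hX] with ω w1 w2 w3 w4 w5
  rw [← ENNReal.tendsto_toReal_iff w4 w5, w3]
  exact w1.congr fun n => (w2 n).symm

end ValueFunction

/-! ### The limit of the value function along an announcing sequence -/

/-- Mean bounds that are summable over `n` give almost sure convergence. -/
theorem ae_tendsto_indicator_tsub_zero {f g : ℕ → Ω → ℝ≥0∞} {B : ℕ → Set Ω}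
    (hf : ∀ n, Measurable (f n)) (hg : ∀ n, Measurable (g n)) (hB : ∀ n, MeasurableSet (B n))
    (hgf : ∀ n, g n ≤ᵐ[P] f n) (hgt : ∀ n, ∫⁻ ω, g n ω ∂P ≠ ∞)
    (h : ∀ n, ∫⁻ ω in B n, f n ω ∂P ≤ ∫⁻ ω in B n, g n ω ∂P + 2⁻¹ ^ n) :
    ∀ᵐ ω ∂P, Tendsto (fun n => (B n).indicator (fun ω => f n ω - g n ω) ω) atTop (𝓝 0) := by
  have hm : ∀ n, Measurable ((B n).indicator fun ω => f n ω - g n ω) := fun n =>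
    ((hf n).sub (hg n)).indicator (hB n)
  have hle : ∀ n, ∫⁻ ω, (B n).indicator (fun ω => f n ω - g n ω) ω ∂P ≤ 2⁻¹ ^ n := fun n => by
    rw [lintegral_indicator (hB n), lintegral_sub (hg n)
      (ne_top_of_le_ne_top (hgt n) (setLIntegral_le_lintegral _ _)) (ae_restrict_of_ae (hgf n))]
    exact tsub_le_iff_left.2 (h n)
  have hsum : ∫⁻ ω, ∑' n, (B n).indicator (fun ω => f n ω - g n ω) ω ∂P ≠ ∞ := by
    rw [lintegral_tsum fun n => (hm n).aemeasurable]
    exact ne_top_of_le_ne_top (by rw [ENNReal.tsum_geometric_two]; simp)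
      (ENNReal.tsum_le_tsum hle)
  filter_upwards [ae_lt_top (Measurable.tsum hm) hsum] with ω hω
  exact ENNReal.tendsto_atTop_zero_of_tsum_ne_top hω.ne

variable [IsProbabilityMeasure P] {φ : PredictableTime 𝓕 P → Ω → ℝ≥0∞}

/-- If `σ` is `δ`-optimal from time `R` on, then it is still `δ`-optimal, on every event known
strictly before `S`, from any time `S` between `R` and `σ` on. -/
theorem setLIntegral_valueFunction_le_add (hU : UsualConditions 𝓕 P) (hφ : IsAdmissible 𝓕 P φ)
    (hφ_sup : (⨆ τ, ∫⁻ ω, φ τ ω ∂P) < ∞) {R S σ : PredictableTime 𝓕 P} {δ : ℝ≥0∞}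
    (hRS : ∀ᵐ ω ∂P, R.1 ω ≤ S.1 ω) (hSσ : ∀ᵐ ω ∂P, S.1 ω ≤ σ.1 ω)
    (hσ : ∫⁻ ω, valueFunction 𝓕 P φ R ω ∂P ≤ ∫⁻ ω, φ σ ω ∂P + δ)
    {A : Set Ω} (hA : MeasurableSet[sigmaBefore 𝓕 S.1] A) :
    ∫⁻ ω in A, valueFunction 𝓕 P φ S ω ∂P ≤ ∫⁻ ω in A, φ σ ω ∂P + δ := by
  have hAm := sigmaBefore_le 𝓕 S.2.1 _ hA
  have hfin : ∫⁻ ω in Aᶜ, valueFunction 𝓕 P φ S ω ∂P ≠ ∞ :=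
    ne_top_of_le_ne_top ((lintegral_valueFunction_le_iSup hU hφ S).trans_lt hφ_sup).ne
      (setLIntegral_le_lintegral _ _)
  refine (ENNReal.add_le_add_iff_right hfin).1 ?_
  calc ∫⁻ ω in A, valueFunction 𝓕 P φ S ω ∂P + ∫⁻ ω in Aᶜ, valueFunction 𝓕 P φ S ω ∂P
      = ∫⁻ ω, valueFunction 𝓕 P φ S ω ∂P := lintegral_add_compl _ hAm
    _ ≤ ∫⁻ ω, φ σ ω ∂P + δ := (lintegral_valueFunction_anti hU hφ hRS).trans hσ
    _ = ∫⁻ ω in A, φ σ ω ∂P + δ + ∫⁻ ω in Aᶜ, φ σ ω ∂P := by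
        rw [← lintegral_add_compl _ hAm, add_right_comm]
    _ ≤ _ := add_le_add le_rfl (setLIntegral_le_valueFunction hSσ hA.compl)

/-- The lower bound: stopping at once yields `φ(τ-)` in the limit, and waiting for a time not before
`τ` yields `V_p(τ)` by Lévy's theorem. -/
theorem max_le_of_tendsto_valueFunction (hU : UsualConditions 𝓕 P) (hφ : IsAdmissible 𝓕 P φ)
    (hφ_sup : (⨆ τ, ∫⁻ ω, φ τ ω ∂P) < ∞) {τ : PredictableTime 𝓕 P} {X : Ω → ℝ≥0∞}
    (hX : IsLeftLimit 𝓕 P φ τ X) {s : ℕ → PredictableTime 𝓕 P}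
    (hs : ∀ᵐ ω ∂P, Monotone (fun n => (s n).1 ω) ∧
      Tendsto (fun n => (s n).1 ω) atTop (𝓝 (τ.1 ω)) ∧ ∀ n, (s n).1 ω < τ.1 ω) :
    ∀ᵐ ω ∂P, ∀ l, Tendsto (fun n => valueFunction 𝓕 P φ (s n) ω) atTop (𝓝 l) →
      max (X ω) (valueFunction 𝓕 P φ τ ω) ≤ l := by
  obtain ⟨σ, hσ, -, hsup⟩ := exists_seq_valueFunction_eq_iSup hU hφ τ
  have hlevy := fun k => tendsto_condLExp_sigmaBefore hU
    (hs.mono fun ω hω => ⟨hω.1, hω.2.1⟩) (hφ.measurable (σ k))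
    ((le_iSup (fun τ => ∫⁻ ω, φ τ ω ∂P) (σ k)).trans_lt hφ_sup).ne
  have hle : ∀ k n, condLExp (sigmaBefore 𝓕 (s n).1) P (φ (σ k)) ≤ᵐ[P]
      valueFunction 𝓕 P φ (s n) := fun k n => by
    refine condLExp_le_valueFunction ?_
    filter_upwards [hs, hσ k] with ω h1 h2 using (h1.2.2 n).le.trans h2
  filter_upwards [hX.2 s hs, ae_all_iff.2 fun n => le_valueFunction hφ (s n), hsup,
    ae_all_iff.2 hlevy, ae_all_iff.2 fun k => ae_all_iff.2 (hle k)] with ω h1 h2 h3 h4 h5 l hl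
  refine max_le (le_of_tendsto_of_tendsto' h1 hl h2) ?_
  rw [h3]
  exact iSup_le fun k => le_of_tendsto_of_tendsto' (h4 k) hl (h5 k)

/-- If `σ` is `δ`-optimal from some announcing time on, then waiting until `τ` loses at most `δ` on
the event that `σ` does not stop before `τ`. -/
theorem setLIntegral_liminf_valueFunction_le (hU : UsualConditions 𝓕 P)
    (hφ : IsAdmissible 𝓕 P φ) (hφ_sup : (⨆ τ, ∫⁻ ω, φ τ ω ∂P) < ∞) {τ : PredictableTime 𝓕 P}
    {s : ℕ → PredictableTime 𝓕 P}
    (hs : ∀ᵐ ω ∂P, Monotone (fun n => (s n).1 ω) ∧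
      Tendsto (fun n => (s n).1 ω) atTop (𝓝 (τ.1 ω)) ∧ ∀ n, (s n).1 ω < τ.1 ω)
    {n : ℕ} {σ : PredictableTime 𝓕 P} {δ : ℝ≥0∞} (hnσ : ∀ᵐ ω ∂P, (s n).1 ω ≤ σ.1 ω)
    (hσ : ∫⁻ ω, valueFunction 𝓕 P φ (s n) ω ∂P ≤ ∫⁻ ω, φ σ ω ∂P + δ) :
    ∫⁻ ω in {ω | τ.1 ω ≤ σ.1 ω}, liminf (fun k => valueFunction 𝓕 P φ (s k) ω) atTop ∂P ≤
      ∫⁻ ω in {ω | τ.1 ω ≤ σ.1 ω}, valueFunction 𝓕 P φ τ ω ∂P + δ := by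
  set B : Set Ω := {ω | τ.1 ω ≤ σ.1 ω} with hB
  set A : ℕ → Set Ω := fun k => {ω | (s k).1 ω < σ.1 ω} with hA
  have hBc : B = {ω | σ.1 ω < τ.1 ω}ᶜ := by ext; simp [hB]
  have hBm' : MeasurableSet[sigmaBefore 𝓕 τ.1] B :=
    hBc ▸ (measurableSet_lt_sigmaBefore σ.2.1).compl
  have hBm : MeasurableSet B := sigmaBefore_le 𝓕 τ.2.1 _ hBm'
  have hAm : ∀ k, MeasurableSet (A k) := fun k =>
    measurableSet_lt (s k).2.1.measurable σ.2.1.measurable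
  have hk : ∀ k ≥ n, ∫⁻ ω in B, valueFunction 𝓕 P φ (s k) ω ∂P ≤
      ∫⁻ ω, (A k).indicator (φ σ) ω ∂P + δ := fun k hk => by
    set S : PredictableTime 𝓕 P := ⟨fun ω => min ((s k).1 ω) (σ.1 ω), (s k).2.min σ.2⟩ with hS
    have hAS : A k = {ω | S.1 ω < σ.1 ω} := by ext; simp [hA, hS]
    have hASm : MeasurableSet[sigmaBefore 𝓕 S.1] (A k) :=
      hAS ▸ measurableSet_lt_sigmaBefore_left hU σ.2
    calc ∫⁻ ω in B, valueFunction 𝓕 P φ (s k) ω ∂P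
        ≤ ∫⁻ ω in A k, valueFunction 𝓕 P φ (s k) ω ∂P := by
          refine lintegral_mono_set' ?_
          filter_upwards [hs] with ω hω hωB
          exact (hω.2.2 k).trans_le hωB
      _ ≤ ∫⁻ ω in A k, valueFunction 𝓕 P φ S ω ∂P := by
          refine setLIntegral_mono_ae' (hAm k) ?_
          filter_upwards [valueFunction_le_of_eq (φ := φ) hU (S := S) (S' := s k)
            (ae_of_all _ fun ω => min_le_left _ _)] with ω hω hωA
          exact hω (min_eq_left (le_of_lt hωA))
      _ ≤ ∫⁻ ω in A k, φ σ ω ∂P + δ := by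
          refine setLIntegral_valueFunction_le_add hU hφ hφ_sup (R := s n) ?_
            (ae_of_all _ fun ω => min_le_right _ _) hσ hASm
          filter_upwards [hs, hnσ] with ω h1 h2 using le_min (h1.1 hk) h2
      _ = _ := by rw [lintegral_indicator (hAm k)]
  have hlim : Tendsto (fun k => ∫⁻ ω, (A k).indicator (φ σ) ω ∂P) atTop
      (𝓝 (∫⁻ ω, B.indicator (φ σ) ω ∂P)) := by
    refine tendsto_lintegral_of_dominated_convergence (φ σ)
      (fun k => (hφ.measurable σ).indicator (hAm k))
      (fun k => ae_of_all _ fun ω => Set.indicator_le_self _ _ _)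
      ((le_iSup (fun τ => ∫⁻ ω, φ τ ω ∂P) σ).trans_lt hφ_sup).ne ?_
    filter_upwards [hs] with ω hω
    refine tendsto_const_nhds.congr' ?_
    by_cases hωB : ω ∈ B
    · refine Eventually.of_forall fun k => ?_
      have hωA : ω ∈ A k := (hω.2.2 k).trans_le hωB
      exact (Set.indicator_of_mem hωB _).trans (Set.indicator_of_mem hωA _).symm
    · filter_upwards [hω.2.1.eventually_const_lt (not_le.1 hωB)] with k hk
      have hωA : ω ∉ A k := not_lt.2 hk.le
      exact (Set.indicator_of_notMem hωB _).trans (Set.indicator_of_notMem hωA _).symm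
  set ρ : PredictableTime 𝓕 P := ⟨fun ω => max (σ.1 ω) (τ.1 ω), σ.2.max τ.2⟩ with hρ
  have hσρ : ∫⁻ ω in B, φ σ ω ∂P = ∫⁻ ω in B, φ ρ ω ∂P := by
    refine setLIntegral_congr_fun_ae hBm ?_
    filter_upwards [hφ.2 σ ρ] with ω hω hωB
    exact hω (max_eq_left hωB).symm
  calc ∫⁻ ω in B, liminf (fun k => valueFunction 𝓕 P φ (s k) ω) atTop ∂P
      ≤ liminf (fun k => ∫⁻ ω in B, valueFunction 𝓕 P φ (s k) ω ∂P) atTop :=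
        lintegral_liminf_le fun k => measurable_valueFunction' (s k)
    _ ≤ liminf (fun k => ∫⁻ ω, (A k).indicator (φ σ) ω ∂P + δ) atTop :=
        liminf_le_liminf (eventually_atTop.2 ⟨n, hk⟩)
    _ = ∫⁻ ω, B.indicator (φ σ) ω ∂P + δ := (hlim.add_const δ).liminf_eq
    _ = ∫⁻ ω in B, φ ρ ω ∂P + δ := by rw [lintegral_indicator hBm, hσρ]
    _ ≤ _ := by
        refine add_le_add_left ?_ δ
        exact setLIntegral_le_valueFunction (S := τ) (σ := ρ)
          (ae_of_all _ fun ω => le_max_right _ _) hBm'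

/-- The upper bound. Let `σ n` be `2⁻ⁿ`-optimal from `s n` on. Where infinitely many `σ n` do not
stop before `τ`, waiting until `τ` loses nothing in the limit. Where almost all `σ n` stop before `τ`,
they approach `τ`, and the value at `σ n` is almost the reward there. The `σ n` need not be
monotone; cut off at suitable announcing times they are interlaced with a subsequence of the
announcing sequence, so that the left limit of `φ` applies to them. -/
theorem le_max_of_tendsto_valueFunction (hU : UsualConditions 𝓕 P) (hφ : IsAdmissible 𝓕 P φ)
    (hφ_sup : (⨆ τ, ∫⁻ ω, φ τ ω ∂P) < ∞) {τ : PredictableTime 𝓕 P} {X : Ω → ℝ≥0∞}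
    (hX : IsLeftLimit 𝓕 P φ τ X) {s : ℕ → PredictableTime 𝓕 P}
    (hs : ∀ᵐ ω ∂P, Monotone (fun n => (s n).1 ω) ∧
      Tendsto (fun n => (s n).1 ω) atTop (𝓝 (τ.1 ω)) ∧ ∀ n, (s n).1 ω < τ.1 ω) :
    ∀ᵐ ω ∂P, ∀ l, Tendsto (fun n => valueFunction 𝓕 P φ (s n) ω) atTop (𝓝 l) →
      l ≤ max (X ω) (valueFunction 𝓕 P φ τ ω) := by
  have hφt : ∀ σ, ∫⁻ ω, φ σ ω ∂P ≠ ∞ := fun σ =>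
    ((le_iSup (fun τ => ∫⁻ ω, φ τ ω ∂P) σ).trans_lt hφ_sup).ne
  have hpow : ∀ n : ℕ, (2⁻¹ : ℝ≥0∞) ^ n ≠ 0 := fun n => (ENNReal.pow_pos (by simp) n).ne'
  choose σ hnσ hσ using fun n => exists_lintegral_valueFunction_le_add hU hφ hφ_sup (s n) (hpow n)
  set L : Ω → ℝ≥0∞ := fun ω => liminf (fun k => valueFunction 𝓕 P φ (s k) ω) atTop with hL
  have hconv := exists_tendsto_valueFunction hU hφ hφ_sup s (hs.mono fun ω hω => hω.1)
  have hlow := max_le_of_tendsto_valueFunction hU hφ hφ_sup hX hs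
  -- Where infinitely many `σ n` do not stop before `τ`, the limit is at most the value at `τ`.
  have hafter : ∀ᵐ ω ∂P, Tendsto (fun n => {ω | τ.1 ω ≤ (σ n).1 ω}.indicator
      (fun ω => L ω - valueFunction 𝓕 P φ τ ω) ω) atTop (𝓝 0) := by
    refine ae_tendsto_indicator_tsub_zero (f := fun _ => L)
      (g := fun _ => valueFunction 𝓕 P φ τ) (fun _ => ?_) (fun _ => measurable_valueFunction' τ)
      (fun n => measurableSet_le τ.2.1.measurable (σ n).2.1.measurable) (fun _ => ?_)
      (fun _ => ((lintegral_valueFunction_le_iSup hU hφ τ).trans_lt hφ_sup).ne)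
      fun n => setLIntegral_liminf_valueFunction_le hU hφ hφ_sup hs (hnσ n) (hσ n)
    · exact Measurable.liminf fun k => measurable_valueFunction' (s k)
    · filter_upwards [hconv, hlow] with ω ⟨l, hl⟩ h2
      have hLω : L ω = l := hl.liminf_eq
      rw [hLω]
      exact (le_max_right _ _).trans (h2 l hl)
  -- Cutting `σ n` off at a late announcing time `s (M n)` changes it with small probability only
  -- where it stops before `τ`.
  have hM : ∀ n, ∃ k, n < k ∧ P {ω | (s k).1 ω < (σ n).1 ω ∧ (σ n).1 ω < τ.1 ω} ≤ 2⁻¹ ^ n := by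
    intro n
    have hlim : Tendsto (fun k => P {ω | (s k).1 ω < (σ n).1 ω ∧ (σ n).1 ω < τ.1 ω}) atTop
        (𝓝 (P ∅)) := by
      refine tendsto_measure_of_ae_tendsto_indicator_of_isFiniteMeasure atTop MeasurableSet.empty
        (fun k => ?_) ?_
      · have h1 : MeasurableSet {ω | (s k).1 ω < (σ n).1 ω} :=
          measurableSet_lt (s k).2.1.measurable (σ n).2.1.measurable
        have h2 : MeasurableSet {ω | (σ n).1 ω < τ.1 ω} :=
          measurableSet_lt (σ n).2.1.measurable τ.2.1.measurable
        exact h1.inter h2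
      · filter_upwards [hs] with ω hω
        by_cases hlt : (σ n).1 ω < τ.1 ω
        · filter_upwards [hω.2.1.eventually_const_lt hlt] with k hk
          exact iff_of_false (fun h => h.1.not_gt hk) (Set.notMem_empty ω)
        · exact Eventually.of_forall fun k => iff_of_false (fun h => hlt h.2) (Set.notMem_empty ω)
    rw [measure_empty] at hlim
    obtain ⟨k, hk1, hk2⟩ := ((eventually_gt_atTop n).and
      (hlim.eventually_lt_const (pos_iff_ne_zero.2 (hpow n)))).exists
    exact ⟨k, hk1, hk2.le⟩
  choose M hnM hM using hM
  have hBC : ∀ᵐ ω ∂P, ∀ᶠ n in atTop, (σ n).1 ω < τ.1 ω → (σ n).1 ω ≤ (s (M n)).1 ω := by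
    have hsum : ∑' n, P {ω | (s (M n)).1 ω < (σ n).1 ω ∧ (σ n).1 ω < τ.1 ω} ≠ ∞ :=
      ne_top_of_le_ne_top (by rw [ENNReal.tsum_geometric_two]; simp) (ENNReal.tsum_le_tsum hM)
    filter_upwards [ae_eventually_notMem hsum] with ω hω
    filter_upwards [hω] with n hn hlt
    exact not_lt.1 fun h => hn ⟨h, hlt⟩
  set ρ : ℕ → PredictableTime 𝓕 P := fun n =>
    ⟨fun ω => min ((s (M n)).1 ω) ((σ n).1 ω), (s (M n)).2.min (σ n).2⟩ with hρ
  have hsρ : ∀ᵐ ω ∂P, ∀ n, (s n).1 ω ≤ (ρ n).1 ω := by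
    filter_upwards [hs, ae_all_iff.2 hnσ] with ω h1 h2 n using le_min (h1.1 (hnM n).le) (h2 n)
  have hDm : ∀ n, MeasurableSet[sigmaBefore 𝓕 (ρ n).1] {ω | (ρ n).1 ω < (σ n).1 ω}ᶜ := fun n =>
    (measurableSet_lt_sigmaBefore_left hU (σ n).2).compl
  -- Where the cut has no effect, the value at `ρ n` is almost exhausted by stopping at `ρ n`.
  have hbefore : ∀ᵐ ω ∂P, Tendsto (fun n => {ω | (ρ n).1 ω < (σ n).1 ω}ᶜ.indicator
      (fun ω => valueFunction 𝓕 P φ (ρ n) ω - φ (ρ n) ω) ω) atTop (𝓝 0) := by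
    refine ae_tendsto_indicator_tsub_zero (f := fun n => valueFunction 𝓕 P φ (ρ n))
      (g := fun n => φ (ρ n)) (fun n => measurable_valueFunction' (ρ n))
      (fun n => hφ.measurable (ρ n)) (fun n => sigmaBefore_le 𝓕 (ρ n).2.1 _ (hDm n))
      (fun n => le_valueFunction hφ (ρ n)) (fun n => hφt (ρ n)) fun n => ?_
    refine (setLIntegral_valueFunction_le_add hU hφ hφ_sup (hsρ.mono fun ω hω => hω n)
      (ae_of_all _ fun ω => min_le_right _ _) (hσ n) (hDm n)).trans (le_of_eq ?_)
    congr 1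
    refine setLIntegral_congr_fun_ae (sigmaBefore_le 𝓕 (ρ n).2.1 _ (hDm n)) ?_
    filter_upwards [hφ.2 (σ n) (ρ n)] with ω hω hωD
    exact hω (le_antisymm (not_lt.1 hωD) (min_le_right _ _))
  -- Along the indices `N k`, announcing times and cut times interlace.
  set N : ℕ → ℕ := fun k => M^[k] 0 with hN
  have hN_succ : ∀ k, N (k + 1) = M (N k) := fun k => Function.iterate_succ_apply' M k 0
  have hN_mono : StrictMono N := strictMono_nat_of_lt_succ fun k => hN_succ k ▸ hnM (N k)
  set u : ℕ → PredictableTime 𝓕 P := fun j =>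
    if Even j then s (N (j / 2)) else ρ (N (j / 2)) with hu
  have hu_even : ∀ k, u (2 * k) = s (N k) := fun k => by simp [hu]
  have hu_odd : ∀ k, u (2 * k + 1) = ρ (N k) := fun k => by
    have h1 : ¬ Even (2 * k + 1) := by simp
    have h2 : (2 * k + 1) / 2 = k := by omega
    simp only [hu, if_neg h1, h2]
  have hρs : ∀ k ω, (ρ (N k)).1 ω ≤ (s (N (k + 1))).1 ω := fun k ω => by
    rw [hN_succ]
    exact min_le_left _ _
  have hu_mono : ∀ᵐ ω ∂P, Monotone fun j => (u j).1 ω := by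
    filter_upwards [hsρ] with ω hω
    refine monotone_nat_of_le_succ fun j => ?_
    obtain ⟨k, rfl | rfl⟩ := Nat.even_or_odd' j
    · rw [hu_even, hu_odd]
      exact hω _
    · rw [show 2 * k + 1 + 1 = 2 * (k + 1) by ring, hu_odd, hu_even]
      exact hρs k ω
  have hρN : ∀ᵐ ω ∂P, Monotone (fun k => (ρ (N k)).1 ω) ∧
      Tendsto (fun k => (ρ (N k)).1 ω) atTop (𝓝 (τ.1 ω)) ∧ ∀ k, (ρ (N k)).1 ω < τ.1 ω := by
    filter_upwards [hs, hsρ] with ω h1 h2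
    have hlim := h1.2.1.comp hN_mono.tendsto_atTop
    refine ⟨monotone_nat_of_le_succ fun k => (hρs k ω).trans (h2 _), ?_,
      fun k => (hρs k ω).trans_lt (h1.2.2 _)⟩
    exact tendsto_of_tendsto_of_tendsto_of_le_of_le hlim ((tendsto_add_atTop_iff_nat 1).2 hlim)
      (fun k => h2 (N k)) fun k => hρs k ω
  filter_upwards [hafter, hBC, hbefore, exists_tendsto_valueFunction hU hφ hφ_sup u hu_mono,
    hX.2 _ hρN] with ω w1 w2 w3 ⟨l', w4⟩ w5 l hl
  by_cases hev : ∀ᶠ n in atTop, (σ n).1 ω < τ.1 ω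
  · refine le_trans ?_ (le_max_left _ _)
    have hkN := hN_mono.tendsto_atTop
    have heven : Tendsto (fun k => 2 * k) atTop atTop :=
      tendsto_atTop_mono (fun k => show k ≤ 2 * k by omega) tendsto_id
    have hodd : Tendsto (fun k => 2 * k + 1) atTop atTop :=
      tendsto_atTop_mono (fun k => show k ≤ 2 * k + 1 by omega) tendsto_id
    have hl' : l' = l := by
      refine tendsto_nhds_unique (w4.comp heven) ((hl.comp hkN).congr fun k => ?_)
      simp only [Function.comp_apply, hu_even]
    have hVρ : Tendsto (fun k => valueFunction 𝓕 P φ (ρ (N k)) ω) atTop (𝓝 l) := by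
      refine hl' ▸ (w4.comp hodd).congr fun k => ?_
      simp only [Function.comp_apply, hu_odd]
    have hsum := w5.add (w3.comp hkN)
    rw [add_zero] at hsum
    refine le_of_tendsto_of_tendsto hVρ hsum ?_
    filter_upwards [hkN.eventually hev, hkN.eventually w2] with k h1 h2
    have hmem : ω ∈ {ω | (ρ (N k)).1 ω < (σ (N k)).1 ω}ᶜ := not_lt.2 (le_min (h2 h1) le_rfl)
    simp only [Function.comp_apply, Set.indicator_of_mem hmem]
    exact le_add_tsub
  · refine le_trans ?_ (le_max_right _ _)
    have hLω : L ω = l := hl.liminf_eq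
    rw [← hLω, ← tsub_eq_zero_iff_le]
    by_contra hne
    refine hev ?_
    filter_upwards [w1.eventually_lt_const (pos_iff_ne_zero.2 hne)] with n hn
    by_contra hnot
    have hmem : ω ∈ {ω | τ.1 ω ≤ (σ n).1 ω} := not_lt.1 hnot
    rw [Set.indicator_of_mem hmem] at hn
    exact lt_irrefl _ hn

/-- The value function converges along every announcing sequence. -/
theorem isLeftLimit_valueFunction (hU : UsualConditions 𝓕 P) (hφ : IsAdmissible 𝓕 P φ)
    (hφ_sup : (⨆ τ, ∫⁻ ω, φ τ ω ∂P) < ∞) {τ : PredictableTime 𝓕 P} {X : Ω → ℝ≥0∞}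
    (hX : IsLeftLimit 𝓕 P φ τ X) : IsLeftLimit 𝓕 P (valueFunction 𝓕 P φ) τ
      fun ω => max (X ω) (valueFunction 𝓕 P φ τ ω) := by
  refine ⟨Measurable.max hX.1 (measurable_valueFunction τ), fun s hs => ?_⟩
  filter_upwards [exists_tendsto_valueFunction hU hφ hφ_sup s (hs.mono fun ω hω => hω.1),
    max_le_of_tendsto_valueFunction hU hφ hφ_sup hX hs,
    le_max_of_tendsto_valueFunction hU hφ hφ_sup hX hs] with ω ⟨l, hl⟩ h1 h2
  rwa [le_antisymm (h1 l hl) (h2 l hl)]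

/-- Left limits are almost surely unique, because a predictable time `τ > 0` is announced by
predictable times. -/
theorem IsLeftLimit.ae_eq (hU : UsualConditions 𝓕 P) (hT : 0 < T) {τ : PredictableTime 𝓕 P}
    (hτ : ∀ᵐ ω ∂P, ⊥ < τ.1 ω) {X Y : Ω → ℝ≥0∞} (hX : IsLeftLimit 𝓕 P φ τ X)
    (hY : IsLeftLimit 𝓕 P φ τ Y) : X =ᵐ[P] Y := by
  obtain ⟨s, hs⟩ := τ.2.exists_announcing hU hT hτ
  filter_upwards [hX.2 s hs, hY.2 s hs] with ω h1 h2 using tendsto_nhds_unique h1 h2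

end

end OptStop

theorem mainTheorem7 {Ω : Type*} {m : MeasurableSpace Ω} (P : Measure Ω) [IsProbabilityMeasure P]
    (T : ℝ≥0) (hT : 0 < T) (𝓕 : Filtration (Set.Iic T) m)
    (h𝓕 : OptStop.UsualConditions 𝓕 P)
    (h𝓕₀ : ∀ A : Set Ω, MeasurableSet[𝓕 ⊥] A → P A = 0 ∨ P A = 1)
    (φ : OptStop.PredictableTime 𝓕 P → Ω → ℝ≥0∞)
    (hφ : OptStop.IsAdmissible 𝓕 P φ)
    (hφ_left : OptStop.IsLeftLimited 𝓕 P φ)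
    (hφ_sup : (⨆ τ, ∫⁻ ω, φ τ ω ∂P) < ∞)
    (τ : OptStop.PredictableTime 𝓕 P) (hτ : ∀ᵐ ω ∂P, ⊥ < τ.1 ω) :
    (∃ Y, OptStop.IsLeftLimit 𝓕 P (OptStop.valueFunction 𝓕 P φ) τ Y) ∧
      ∀ X Y : Ω → ℝ≥0∞, OptStop.IsLeftLimit 𝓕 P φ τ X →
        OptStop.IsLeftLimit 𝓕 P (OptStop.valueFunction 𝓕 P φ) τ Y →
        ∀ᵐ ω ∂P, Y ω = max (X ω) (OptStop.valueFunction 𝓕 P φ τ ω) := by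
  obtain ⟨X₀, hX₀⟩ := hφ_left τ hτ
  refine ⟨⟨_, OptStop.isLeftLimit_valueFunction h𝓕 hφ hφ_sup hX₀⟩, fun X Y hX hY => ?_⟩
  exact hY.ae_eq h𝓕 hT hτ (OptStop.isLeftLimit_valueFunction h𝓕 hφ hφ_sup hX)
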